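/- Let $n \ge 0$, write $[n] = \{1,\dots,n\}$, and let $R = \mathbb{C}[\,y_B : \varnothing \neq B \subseteq [n]\,]$ be the polynomial ring in $2^n-1$ commuting variables. Two disjoint sets $A, B \subseteq [n]$ are said to cross if there are $a<b<c<d$ such that $a,c$ lie in one of the two sets and $b,d$ lie in the other. A family of pairwise disjoint sets is noncrossing if no two of its members cross. Let $A,B\subseteq[n]$ be disjoint sets which cross. Write $A = A_1 \sqcup \cdots \sqcup A_m$ and $B = B_1 \sqcup \cdots \sqcup B_m$, where the $A_i$ (respectively the $B_i$) are the maximal nonempty cyclic intervals of the ordered set $A \sqcup B$ that are contained in $A$ (respectively in $B$). For a partition $\{S/T\}$ of $A \sqcup B$ into two nonempty blocks, let $\epsilon(S,T)=+1$ if $|S|,|T|\ge 2$ and $S$ and $T$ are both unions of an odd number of the sets $A_1,B_1,\dots,A_m,B_m$; let $\epsilon(S,T)=-1$ if $|S|,|T|\ge 2$ and $S$ and $T$ are both unions of an even number of these sets; and let $\epsilon(S,T)=0$ otherwise. Let $I \subseteq R$ be the ideal generated by the elements $$ y_A y_B - \sum_{\{S/T\}} \epsilon(S,T)\, y_S y_T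 $$ for all disjoint pairs $A, B \subseteq [n]$ which cross, where the sum is over all unordered noncrossing partitions $\{S/T\}$ of $A\sqcup B$ into two nonempty blocks. Let $J = \langle\, y_A y_B : A \cap B \neq \varnothing \,\rangle \subseteq R$, where $A = B$ is allowed. Proposition 6.8. The images in $R/(I+J)$ of the monomials $y_{B_1}\cdots y_{B_k}$, where $k\ge 0$ and $\{B_1,\dots,B_k\}$ runs over all families of pairwise disjoint, noncrossing, nonempty subsets of $[n]$ (distinct families giving distinct elements), form a basis of $R/(I+J)$ as a vector space over $\mathbb{C}$. -/

import Mathlib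

/-- The nonempty subsets of an `n`-element linearly ordered set; they index the variables. -/
abbrev Block (n : ℕ) : Type := {B : Finset (Fin n) // B.Nonempty}

/-- Two sets cross if there are `a < b < c < d` with `a, c` in one of them and `b, d` in the
other. -/
def Crosses {n : ℕ} (A B : Finset (Fin n)) : Prop :=
  ∃ a b c d : Fin n, a < b ∧ b < c ∧ c < d ∧
    ((a ∈ A ∧ c ∈ A ∧ b ∈ B ∧ d ∈ B) ∨ (a ∈ B ∧ c ∈ B ∧ b ∈ A ∧ d ∈ A))

/-- The members of the family are pairwise disjoint and pairwise do not cross; in other words,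
the family is a noncrossing set partition of its union. -/
def IsNoncrossingFamily {n : ℕ} (P : Finset (Block n)) : Prop :=
  ∀ S ∈ P, ∀ T ∈ P, S ≠ T → Disjoint S.1 T.1 ∧ ¬ Crosses S.1 T.1

/-- The closed cyclic interval from `i` to `j` in the ordered set `U`. -/
def cyclicInterval {n : ℕ} (U : Finset (Fin n)) (i j : Fin n) : Finset (Fin n) :=
  if i ≤ j then U.filter (fun x => i ≤ x ∧ x ≤ j) else U.filter (fun x => i ≤ x ∨ x ≤ j)

/-- `C` is a nonempty cyclic interval of the ordered set `U`. -/
def IsCyclicInterval {n : ℕ} (U C : Finset (Fin n)) : Prop :=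
  ∃ i ∈ U, ∃ j ∈ U, C = cyclicInterval U i j

open Classical in
/-- The maximal nonempty cyclic intervals of `U` that are contained in `A`. -/
noncomputable def maximalIntervals {n : ℕ} (U A : Finset (Fin n)) : Finset (Finset (Fin n)) :=
  A.powerset.filter (fun C => Maximal (fun D => IsCyclicInterval U D ∧ D ⊆ A) C)

/-- The sets `A₁, B₁, …, A_m, B_m`: the maximal nonempty cyclic intervals of the ordered set
`A ∪ B` which are contained in `A` or in `B`. -/
noncomputable def intervalPieces {n : ℕ} (A B : Finset (Fin n)) : Finset (Finset (Fin n)) :=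
  maximalIntervals (A ∪ B) A ∪ maximalIntervals (A ∪ B) B

/-- `S` is the union of an odd number of the sets `A₁, B₁, …, A_m, B_m`. -/
def IsOddUnion {n : ℕ} (A B S : Finset (Fin n)) : Prop :=
  ∃ F ⊆ intervalPieces A B, Odd F.card ∧ F.biUnion id = S

/-- `S` is the union of an even number of the sets `A₁, B₁, …, A_m, B_m`. -/
def IsEvenUnion {n : ℕ} (A B S : Finset (Fin n)) : Prop :=
  ∃ F ⊆ intervalPieces A B, Even F.card ∧ F.biUnion id = S

open Classical in
/-- The coefficient `ε(S, T)` of the unordered pair `P = {S, T}` in the resolution of the crossing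
of `A` and `B`. It is zero if `S` or `T` is a singleton, and also if `S` and `T` are not unions of
some of the sets `A₁, B₁, …, A_m, B_m`. -/
noncomputable def resolutionCoeff {n : ℕ} (A B : Finset (Fin n)) (P : Finset (Block n)) : ℤ :=
  if ∃ S ∈ P, S.1.card < 2 then 0
  else if ∀ S ∈ P, IsOddUnion A B S.1 then 1
  else if ∀ S ∈ P, IsEvenUnion A B S.1 then -1
  else 0

open Classical in
/-- The noncrossing set partitions `{S / T}` of `U` with exactly two blocks. -/
noncomputable def twoBlockNoncrossing {n : ℕ} (U : Finset (Fin n)) : Finset (Finset (Block n)) :=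
  Finset.univ.filter
    (fun P => P.card = 2 ∧ IsNoncrossingFamily P ∧ P.biUnion (fun S => S.1) = U)

/-- The monomial `y_{B₁} ⋯ y_{B_k}` of a family `{B₁, …, B_k}` of distinct nonempty sets. -/
noncomputable def blockMonomial {n : ℕ} (P : Finset (Block n)) : MvPolynomial (Block n) ℂ :=
  ∏ B ∈ P, MvPolynomial.X B

/-- The quadratic crossing-resolution relation of a pair `A, B`:
`y_A y_B - ∑ ε(S, T) y_S y_T`, summed over the two-block noncrossing partitions `{S / T}` of
`A ∪ B`. -/
noncomputable def crossingRelation {n : ℕ} (A B : Block n) : MvPolynomial (Block n) ℂ :=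
  MvPolynomial.X A * MvPolynomial.X B -
    ∑ P ∈ twoBlockNoncrossing (A.1 ∪ B.1), resolutionCoeff A.1 B.1 P • blockMonomial P

/-- The ideal `I`, generated by the relations of all disjoint pairs `A, B` which cross. -/
noncomputable def crossingIdeal (n : ℕ) : Ideal (MvPolynomial (Block n) ℂ) :=
  Ideal.span {f | ∃ A B : Block n, Disjoint A.1 B.1 ∧ Crosses A.1 B.1 ∧ f = crossingRelation A B}

/-- The ideal `J`, generated by the products `y_A y_B` with `A ∩ B ≠ ∅` (including `A = B`). -/
noncomputable def overlapIdeal (n : ℕ) : Ideal (MvPolynomial (Block n) ℂ) :=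
  Ideal.span {f | ∃ A B : Block n, (A.1 ∩ B.1).Nonempty ∧
    f = MvPolynomial.X A * MvPolynomial.X B}

/-! Spanning is a rewriting argument. Products of overlapping blocks vanish by J. If two disjoint
blocks A, B cross, the relation replaces y_A y_B by pairs {S/T}, and every pair with nonzero
coefficient lowers the number of crossings of the family (`crossingNumber_resolve_lt`): the crossing
of A and B disappears, and a third block crosses at most as many of S, T as of A, B.

Independence uses a model over the commutative ring K generated by the products s i j = e_i e_j in
an exterior algebra. For |B| ≥ 2, y_B goes to the sum over i, j in B of s i j times the word that
marks i as opener, j as closer and the rest of B as middle; singletons get a letter of their own.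
For fixed U = S ⊔ T, antisymmetry of s makes the product of the images of S and T the value Q(1_S)
of a quadratic form whose matrix has zero row and column sums
(`pairPoly_mul_pairPoly_eq_quadratic`). Up to a constant, 1_A is the sum of δ_p 1_{≥ p}, where δ_p
are the jumps of 1_A around the cyclic order U and sum to zero. Hence Q(1_A) = -∑_{p<q} δ_p δ_q
Q(1_{[p,q)}). The noncrossing partitions of U into two blocks are exactly the cuts into [p,q) and
its complement, and ε = -δ_p δ_q if both blocks have at least two elements (`resolutionCoeff_cut`);
otherwise both terms vanish. So I goes to zero, and J goes to words with two letters at one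
position.

Weigh words by the positions of closers minus those of openers. A block of at least two elements
then has its leading word opened at its minimum and closed at its maximum. The leading coefficient
of a noncrossing family is a nonzero product of distinct e_i, and its leading word determines the
family (`familyWord_injOn`), which excludes linear relations. -/

/-! ### The coefficient ring. -/

/-- Even products in an exterior algebra: a commutative ring with totally antisymmetric
products `s i j * s k l`. -/
theorem exists_antisymmetric_pairing (n : ℕ) :
    ∃ (K : Type) (_ : CommRing K) (_ : Algebra ℂ K) (s : Fin n → Fin n → K),
      (∀ i, s i i = 0) ∧
      (∀ i j k l, s i j * s k l = - (s k j * s i l)) ∧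
      (∀ i j k l, s i j * s k l = - (s i l * s k j)) ∧
      (∀ L : List (Fin n × Fin n), (L.flatMap fun p => [p.1, p.2]).Nodup →
        (L.map fun p => s p.1 p.2).prod ≠ 0) := by
  classical
  let V := Fin n → ℂ
  let e : Fin n → ExteriorAlgebra ℂ V := fun i => ExteriorAlgebra.ι ℂ (Pi.single i 1)
  have sq (i) : e i * e i = 0 := ExteriorAlgebra.ι_sq_zero _
  have anti (i j) : e i * e j = - (e j * e i) := by
    have := ExteriorAlgebra.ι_add_mul_swap (R := ℂ) (Pi.single i 1 : V) (Pi.single j 1)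
    exact eq_neg_of_add_eq_zero_left this
  let S : Set (ExteriorAlgebra ℂ V) := Set.range fun p : Fin n × Fin n => e p.1 * e p.2
  -- Passing two generators across two others takes four transpositions, so the signs cancel.
  have comm4 (i j k l) : e i * e j * (e k * e l) = e k * e l * (e i * e j) := by
    calc e i * e j * (e k * e l) = e i * (e j * e k) * e l := by noncomm_ring
      _ = - (e i * e k * (e j * e l)) := by rw [anti j k]; noncomm_ring
      _ = - (e k * (e i * e l) * e j) := by rw [anti i k, anti j l]; noncomm_ring
      _ = e k * e l * (e i * e j) := by rw [anti i l]; noncomm_ring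
  have hS : ∀ a ∈ S, ∀ b ∈ S, a * b = b * a := by
    rintro _ ⟨⟨i, j⟩, rfl⟩ _ ⟨⟨k, l⟩, rfl⟩
    exact comm4 i j k l
  -- Contraction with the `a`-th coordinate strips a leading `e a` and kills products of the other
  -- generators; by induction, products of distinct generators are nonzero.
  let d : Fin n → Module.Dual ℂ V := fun i => LinearMap.proj i
  have contract (i j) (x) : CliffordAlgebra.contractLeft (d i) (e j * x) =
      (if i = j then (1 : ℂ) else 0) • x - e j * CliffordAlgebra.contractLeft (d i) x := by
    have := CliffordAlgebra.contractLeft_ι_mul (Q := (0 : QuadraticForm ℂ V)) (d := d i)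
      (Pi.single j 1) x
    have h : d i (Pi.single j 1) = if i = j then (1 : ℂ) else 0 := Pi.single_apply _ _ _
    rw [h] at this
    exact this
  have contract_list (i) (L : List (Fin n)) (h : i ∉ L) :
      CliffordAlgebra.contractLeft (Q := (0 : QuadraticForm ℂ V)) (d i) ((L.map e).prod) = 0 := by
    induction L with
    | nil => simp [CliffordAlgebra.contractLeft_one]
    | cons a L ih =>
      simp only [List.mem_cons, not_or] at h
      rw [List.map_cons, List.prod_cons, contract, ih h.2]
      simp [h.1]
  have nonzero (L : List (Fin n)) (h : L.Nodup) : (L.map e).prod ≠ 0 := by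
    induction L with
    | nil => simp
    | cons a L ih =>
      intro h0
      rw [List.nodup_cons] at h
      apply ih h.2
      have := congrArg (CliffordAlgebra.contractLeft (Q := (0 : QuadraticForm ℂ V)) (d a)) h0
      rw [List.map_cons, List.prod_cons, contract, contract_list a L h.1] at this
      simpa using this
  let s : Fin n → Fin n → Algebra.adjoin ℂ S := fun i j =>
    ⟨e i * e j, Algebra.subset_adjoin ⟨(i, j), rfl⟩⟩
  have hcomm := Algebra.isMulCommutative_adjoin ℂ hS
  refine ⟨Algebra.adjoin ℂ S,
    { (inferInstance : Ring (Algebra.adjoin ℂ S)) with mul_comm := hcomm.is_comm.comm },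
    inferInstanceAs (Algebra ℂ (Algebra.adjoin ℂ S)), s, ?_, ?_, ?_, ?_⟩
  · intro i
    exact Subtype.ext (sq i)
  · intro i j k l
    apply Subtype.ext
    change e i * e j * (e k * e l) = - (e k * e j * (e i * e l))
    calc e i * e j * (e k * e l) = e i * (e j * e k) * e l := by noncomm_ring
      _ = - (e i * e k * (e j * e l)) := by rw [anti j k]; noncomm_ring
      _ = e k * (e i * e j) * e l := by rw [anti i k]; noncomm_ring
      _ = _ := by rw [anti i j]; noncomm_ring
  · intro i j k l
    apply Subtype.ext
    change e i * e j * (e k * e l) = - (e i * e l * (e k * e j))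
    calc e i * e j * (e k * e l) = e i * (e j * e k) * e l := by noncomm_ring
      _ = - (e i * e k * (e j * e l)) := by rw [anti j k]; noncomm_ring
      _ = e i * (e k * e l) * e j := by rw [anti j l]; noncomm_ring
      _ = _ := by rw [anti k l]; noncomm_ring
  · intro L hL h0
    have key : ∀ L : List (Fin n × Fin n),
        (((L.map fun p => s p.1 p.2).prod : Algebra.adjoin ℂ S) : ExteriorAlgebra ℂ V) =
          ((L.flatMap fun p => [p.1, p.2]).map e).prod := by
      intro L
      induction L with
      | nil => rfl
      | cons a L ih =>
        rw [List.map_cons, List.prod_cons, List.flatMap_cons, List.map_append, List.prod_append,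
          ← ih]
        simp only [List.map_cons, List.map_nil, List.prod_cons, List.prod_nil, mul_one]
        rfl
    apply nonzero _ hL
    rw [← key]
    exact congrArg Subtype.val h0

/-! ### Quadratic forms evaluated on step functions. -/

section QuadraticIdentity

/-- Summation by parts for the values of a bilinear form on differences. -/
theorem LinearMap.sum_mul_apply_sub_sub {M V ι : Type*} [CommRing M] [AddCommGroup V] [Module M V]
    (b : V →ₗ[M] V →ₗ[M] M) (U : Finset ι) (δ : ι → M) (e : ι → V) (hδ : ∑ p ∈ U, δ p = 0) :
    ∑ p ∈ U, ∑ q ∈ U, δ p * δ q * b (e p - e q) (e p - e q) =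
      - (2 * b (∑ p ∈ U, δ p • e p) (∑ p ∈ U, δ p • e p)) := by
  -- Since `δ` sums to zero, only the two mixed terms survive, each giving the value at the weighted
  -- sum.
  have h1 : ∑ p ∈ U, ∑ q ∈ U, δ p * δ q * b (e p) (e p) = 0 := by
    calc _ = ∑ p ∈ U, (δ p * b (e p) (e p)) * ∑ q ∈ U, δ q := by
          refine Finset.sum_congr rfl fun p _ => ?_
          rw [Finset.mul_sum]
          exact Finset.sum_congr rfl fun q _ => by ring
      _ = 0 := by simp [hδ]
  have h2 : ∑ p ∈ U, ∑ q ∈ U, δ p * δ q * b (e q) (e q) = 0 := by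
    rw [Finset.sum_comm, ← h1]
    exact Finset.sum_congr rfl fun p _ => Finset.sum_congr rfl fun q _ => by ring
  have h3 : ∑ p ∈ U, ∑ q ∈ U, δ p * δ q * b (e p) (e q) =
      b (∑ p ∈ U, δ p • e p) (∑ p ∈ U, δ p • e p) := by
    simp only [map_sum, map_smul, LinearMap.sum_apply, LinearMap.smul_apply, smul_eq_mul,
      Finset.mul_sum]
    rw [Finset.sum_comm]
    exact Finset.sum_congr rfl fun p _ => Finset.sum_congr rfl fun q _ => by ring
  have h4 : ∑ p ∈ U, ∑ q ∈ U, δ p * δ q * b (e q) (e p) =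
      b (∑ p ∈ U, δ p • e p) (∑ p ∈ U, δ p • e p) := by
    rw [Finset.sum_comm, ← h3]
    exact Finset.sum_congr rfl fun p _ => Finset.sum_congr rfl fun q _ => by ring
  have expand : ∀ p q, δ p * δ q * b (e p - e q) (e p - e q) =
      δ p * δ q * b (e p) (e p) + δ p * δ q * b (e q) (e q)
        - (δ p * δ q * b (e p) (e q) + δ p * δ q * b (e q) (e p)) := by
    intro p q
    simp only [map_sub, LinearMap.sub_apply]
    ring
  simp only [expand, Finset.sum_add_distrib, Finset.sum_sub_distrib, h1, h2, h3, h4]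
  ring

theorem Finset.sum_sum_eq_two_mul_sum_lt {M ι : Type*} [CommRing M] [LinearOrder ι]
    (U : Finset ι) (f : ι → ι → M) (hs : ∀ p q, f p q = f q p) (h0 : ∀ p, f p p = 0) :
    ∑ p ∈ U, ∑ q ∈ U, f p q = 2 * ∑ p ∈ U, ∑ q ∈ U with p < q, f p q := by
  have h1 : ∀ p q, f p q = (if p < q then f p q else 0) + (if q < p then f q p else 0) := by
    intro p q
    rcases lt_trichotomy p q with h | h | h
    · simp [h, h.not_gt]
    · simp [h, h0]
    · simp [h, h.not_gt, hs p q]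
  have h2 : ∑ p ∈ U, ∑ q ∈ U, (if q < p then f q p else 0) =
      ∑ p ∈ U, ∑ q ∈ U, (if p < q then f p q else 0) := Finset.sum_comm
  calc _ = ∑ p ∈ U, ∑ q ∈ U, ((if p < q then f p q else 0) + (if q < p then f q p else 0)) :=
        Finset.sum_congr rfl fun p _ => Finset.sum_congr rfl fun q _ => h1 p q
    _ = _ := by
      simp only [Finset.sum_add_distrib, h2, Finset.sum_filter]
      ring

/-- A quadratic form on functions on the ordered set `U` that is degenerate along constants: its
value at the indicator of `A` is the alternating sum of its values at the intervals `[p, q)` of `U`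
which are cut out by the ends of the runs of `A`. -/
theorem sum_interval_cuts {M : Type*} [CommRing M] [Algebra ℚ M] {n : ℕ}
    (U A : Finset (Fin n)) (hAU : A ⊆ U) (K : Fin n → Fin n → M)
    (hrow : ∀ j ∈ U, ∑ i ∈ U, K i j = 0) (hcol : ∀ i ∈ U, ∑ j ∈ U, K i j = 0)
    (δ : Fin n → ℤ) (c₀ : ℤ) (hδ : ∑ p ∈ U, δ p = 0)
    (hc : ∀ i ∈ U, (if i ∈ A then 1 else 0) = c₀ + ∑ p ∈ U with p ≤ i, δ p) :
    ∑ p ∈ U, ∑ q ∈ U with p < q,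
        (-(δ p * δ q) : ℤ) • ∑ i ∈ U with p ≤ i ∧ i < q, ∑ j ∈ U with p ≤ j ∧ j < q, K i j =
      ∑ i ∈ A, ∑ j ∈ A, K i j := by
  classical
  -- The form is cut off outside `U`, so only the values of functions on `U` matter.
  let b : (Fin n → M) →ₗ[M] (Fin n → M) →ₗ[M] M :=
    Matrix.toLinearMap₂' M (Matrix.of fun i j => if i ∈ U ∧ j ∈ U then K i j else 0)
  have hb (v w) : b v w = ∑ i ∈ U, ∑ j ∈ U, v i * w j * K i j := by
    simp only [b, Matrix.toLinearMap₂'_apply, Matrix.of_apply, ite_and, smul_eq_mul]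
    rw [← Finset.sum_filter_add_sum_filter_not Finset.univ (· ∈ U)]
    simp only [Finset.filter_mem_eq_inter, Finset.univ_inter]
    rw [add_eq_left.2 (Finset.sum_eq_zero fun i hi => by simp [(Finset.mem_filter.1 hi).2])]
    refine Finset.sum_congr rfl fun i hi => ?_
    simp only [hi, if_true, mul_ite, mul_zero, ← Finset.sum_filter, Finset.filter_mem_eq_inter,
      Finset.univ_inter, mul_assoc]
  let e : Fin n → Fin n → M := fun p i => if p ≤ i then 1 else 0
  have ind (S : Finset (Fin n)) (hS : S ⊆ U) :
      b (fun i => if i ∈ S then 1 else 0) (fun i => if i ∈ S then 1 else 0) =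
        ∑ i ∈ S, ∑ j ∈ S, K i j := by
    rw [hb, ← Finset.sum_subset hS fun i _ hi => Finset.sum_eq_zero fun j _ => by simp [hi]]
    refine Finset.sum_congr rfl fun i hi => ?_
    rw [← Finset.sum_subset hS fun j _ hj => by simp [hj]]
    exact Finset.sum_congr rfl fun j hj => by simp [hi, hj]
  have cut (p q) (hpq : p < q) : b (e p - e q) (e p - e q) =
      ∑ i ∈ U with p ≤ i ∧ i < q, ∑ j ∈ U with p ≤ j ∧ j < q, K i j := by
    rw [← ind _ (Finset.filter_subset _ _), hb, hb]
    have : ∀ i ∈ U, (e p - e q) i = if i ∈ U.filter (fun i => p ≤ i ∧ i < q) then 1 else 0 := by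
      intro i hi
      simp only [e, Pi.sub_apply, Finset.mem_filter, hi, true_and]
      rcases lt_or_ge i q with h | h
      · simp [h, h.not_ge]
      · simp [h, h.not_gt, hpq.le.trans h]
    exact Finset.sum_congr rfl fun i hi => Finset.sum_congr rfl fun j hj => by
      rw [this i hi, this j hj]
  have hE : ∀ i ∈ U, (∑ p ∈ U, (δ p : M) • e p) i = (if i ∈ A then 1 else 0) - (c₀ : M) := by
    intro i hi
    have h := congrArg (Int.cast : ℤ → M) (hc i hi)
    push_cast at h
    rw [h, add_sub_cancel_left, Finset.sum_apply, Finset.sum_filter]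
    refine Finset.sum_congr rfl fun p _ => ?_
    simp [e]
  have hbE : b (∑ p ∈ U, (δ p : M) • e p) (∑ p ∈ U, (δ p : M) • e p) =
      ∑ i ∈ A, ∑ j ∈ A, K i j := by
    rw [← ind A hAU, hb, hb]
    -- The combination of steps is the indicator of `A` minus `c₀`. The constant is killed in the
    -- second argument by `hcol`, and afterwards in the first by `hrow`.
    have h1 : ∀ i ∈ U, ∑ j ∈ U, (∑ p ∈ U, (δ p : M) • e p) i * (∑ p ∈ U, (δ p : M) • e p) j * K i j
        = ∑ j ∈ U, (∑ p ∈ U, (δ p : M) • e p) i * (if j ∈ A then 1 else 0) * K i j := by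
      intro i hi
      rw [← sub_eq_zero, ← Finset.sum_sub_distrib]
      calc _ = ∑ j ∈ U, - ((∑ p ∈ U, (δ p : M) • e p) i * c₀) * K i j :=
            Finset.sum_congr rfl fun j hj => by rw [hE j hj]; ring
        _ = 0 := by rw [← Finset.mul_sum, hcol i hi, mul_zero]
    rw [Finset.sum_congr rfl h1, Finset.sum_comm]
    conv_rhs => rw [Finset.sum_comm]
    refine Finset.sum_congr rfl fun j hj => ?_
    rw [← sub_eq_zero, ← Finset.sum_sub_distrib]
    calc _ = ∑ i ∈ U, - ((if j ∈ A then 1 else 0) * c₀) * K i j :=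
          Finset.sum_congr rfl fun i hi => by rw [hE i hi]; ring
      _ = 0 := by rw [← Finset.mul_sum, hrow j hj, mul_zero]
  have hδM : ∑ p ∈ U, (δ p : M) = 0 := by exact_mod_cast congrArg (Int.cast : ℤ → M) hδ
  have key := LinearMap.sum_mul_apply_sub_sub b U (fun p => (δ p : M)) e hδM
  have hsymm (p q) : (δ p : M) * δ q * b (e p - e q) (e p - e q) =
      δ q * δ p * b (e q - e p) (e q - e p) := by
    rw [← neg_sub (e p) (e q), LinearMap.map_neg₂, map_neg]
    ring
  have hdiag (p) : (δ p : M) * δ p * b (e p - e p) (e p - e p) = 0 := by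
    rw [sub_self, map_zero, mul_zero]
  rw [Finset.sum_sum_eq_two_mul_sum_lt U _ hsymm hdiag, hbE, ← mul_neg] at key
  have h2 : IsUnit (2 : M) := by
    have : (2 : M) = algebraMap ℚ M 2 := (map_ofNat _ 2).symm
    rw [this]
    exact (IsUnit.mk0 (2 : ℚ) two_ne_zero).map _
  rw [h2.mul_right_inj] at key
  rw [← neg_eq_iff_eq_neg.2 key, ← Finset.sum_neg_distrib]
  refine Finset.sum_congr rfl fun p _ => ?_
  rw [← Finset.sum_neg_distrib]
  refine Finset.sum_congr rfl fun q hq => ?_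
  rw [cut p q (Finset.mem_filter.1 hq).2, zsmul_eq_mul]
  push_cast
  ring

end QuadraticIdentity

/-! ### Opener-closer polynomials and their products. -/

section PairPolynomial

/-- The letter at `k` of a set in which `i` is opened, `j` is closed. -/
def pairLabel {n : ℕ} (i j k : Fin n) : Fin 4 := if k = i then 0 else if k = j then 1 else 2

/-- The generating polynomial of the ways to choose an opener and a closer in `B`. -/
noncomputable def pairPoly {n : ℕ} {K : Type*} [CommRing K] (s : Fin n → Fin n → K)
    (B : Finset (Fin n)) : MvPolynomial (Fin 4 × Fin n) K :=
  ∑ i ∈ B, ∑ j ∈ B, MvPolynomial.C (s i j) * ∏ k ∈ B, MvPolynomial.X (pairLabel i j k, k)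

/-- The common polynomial of the choices of two openers `i, k` and two closers `j, l` in `U`. -/
noncomputable def twoPairTerm {n : ℕ} {K : Type*} [CommRing K] (s : Fin n → Fin n → K)
    (U : Finset (Fin n)) (i j k l : Fin n) : MvPolynomial (Fin 4 × Fin n) K :=
  MvPolynomial.C (s i j * s k l) * ∏ m ∈ U,
    MvPolynomial.X ((if m = i ∨ m = k then 0 else if m = j ∨ m = l then 1 else 2 : Fin 4), m)

variable {n : ℕ} {K : Type*} [CommRing K] (s : Fin n → Fin n → K)

/-- The word does not record which opener is paired with which closer, so only the sign of the
coefficient changes. -/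
theorem twoPairTerm_swap_openers (h : ∀ i j k l, s i j * s k l = - (s k j * s i l))
    (U : Finset (Fin n)) (i j k l : Fin n) :
    twoPairTerm s U i j k l = - twoPairTerm s U k j i l := by
  simp only [twoPairTerm, h i j k l, or_comm (a := _ = i), map_neg, neg_mul]

theorem twoPairTerm_swap_closers (h : ∀ i j k l, s i j * s k l = - (s i l * s k j))
    (U : Finset (Fin n)) (i j k l : Fin n) :
    twoPairTerm s U i j k l = - twoPairTerm s U i l k j := by
  simp only [twoPairTerm, h i j k l, or_comm (a := _ = j), map_neg, neg_mul]

theorem pairPoly_mul_pairPoly {S T : Finset (Fin n)} (hST : Disjoint S T) :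
    pairPoly s S * pairPoly s T =
      ∑ i ∈ S, ∑ j ∈ S, ∑ k ∈ T, ∑ l ∈ T, twoPairTerm s (S ∪ T) i j k l := by
  rw [pairPoly, pairPoly, Finset.sum_mul]
  refine Finset.sum_congr rfl fun i hi => ?_
  rw [Finset.sum_mul]
  refine Finset.sum_congr rfl fun j hj => ?_
  rw [Finset.mul_sum]
  refine Finset.sum_congr rfl fun k hk => ?_
  rw [Finset.mul_sum]
  refine Finset.sum_congr rfl fun l hl => ?_
  have hS : ∀ m ∈ S, ∀ a ∈ T, m ≠ a := fun m hm a ha => by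
    rintro rfl; exact Finset.disjoint_left.1 hST hm ha
  rw [twoPairTerm, Finset.prod_union hST, map_mul, mul_mul_mul_comm]
  congr 2
  · refine Finset.prod_congr rfl fun m hm => ?_
    simp [pairLabel, hS m hm k hk, hS m hm l hl]
  · refine Finset.prod_congr rfl fun m hm => ?_
    simp [pairLabel, (hS i hi m hm).symm, (hS j hj m hm).symm]

theorem Finset.sum_sum_eq_zero_of_antisymm {M ι : Type*} [CommRing M] [Algebra ℚ M]
    (S : Finset ι) (f : ι → ι → M) (h : ∀ i k, f i k = - f k i) :
    ∑ i ∈ S, ∑ k ∈ S, f i k = 0 := by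
  have h1 : ∑ i ∈ S, ∑ k ∈ S, f i k = - ∑ i ∈ S, ∑ k ∈ S, f i k := by
    conv_rhs => rw [Finset.sum_comm]
    rw [← Finset.sum_neg_distrib]
    refine Finset.sum_congr rfl fun i _ => ?_
    rw [← Finset.sum_neg_distrib]
    exact Finset.sum_congr rfl fun k _ => h i k
  have := IsAddTorsionFree.of_module_rat M
  exact self_eq_neg.1 h1

/-- The products `pairPoly S * pairPoly T` over the splittings `U = S ⊔ T` are the values at the
indicator of `S` of a quadratic form. -/
theorem pairPoly_mul_pairPoly_eq_quadratic [Algebra ℚ K]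
    (h₁ : ∀ i j k l, s i j * s k l = - (s k j * s i l))
    (h₂ : ∀ i j k l, s i j * s k l = - (s i l * s k j))
    {S T : Finset (Fin n)} (hST : Disjoint S T) :
    pairPoly s S * pairPoly s T =
      ∑ i ∈ S, ∑ j ∈ S, ∑ k ∈ S ∪ T, ∑ l ∈ S ∪ T, twoPairTerm s (S ∪ T) i j k l := by
  classical
  rw [pairPoly_mul_pairPoly s hST]
  set G := twoPairTerm s (S ∪ T) with hG
  have a₁ := twoPairTerm_swap_openers s h₁ (S ∪ T)
  have a₂ := twoPairTerm_swap_closers s h₂ (S ∪ T)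
  rw [← hG] at a₁ a₂
  -- Letting `k` and `l` range over `S ∪ T` instead of `T` adds nothing: terms with both openers in
  -- `S` cancel under their exchange, and likewise for closers.
  have e₁ : ∑ i ∈ S, ∑ j ∈ S, ∑ k ∈ S, ∑ l ∈ S ∪ T, G i j k l = 0 := by
    have : ∀ i ∈ S, ∑ j ∈ S, ∑ k ∈ S, ∑ l ∈ S ∪ T, G i j k l =
        ∑ k ∈ S, ∑ j ∈ S, ∑ l ∈ S ∪ T, G i j k l := fun i _ => Finset.sum_comm
    rw [Finset.sum_congr rfl this]
    apply Finset.sum_sum_eq_zero_of_antisymm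
    intro i k
    simp only [← Finset.sum_neg_distrib]
    exact Finset.sum_congr rfl fun j _ => Finset.sum_congr rfl fun l _ => a₁ i j k l
  have e₂ : ∀ i ∈ S, ∑ j ∈ S, ∑ k ∈ T, ∑ l ∈ S, G i j k l = 0 := by
    intro i _
    have : ∀ j ∈ S, ∑ k ∈ T, ∑ l ∈ S, G i j k l = ∑ l ∈ S, ∑ k ∈ T, G i j k l :=
      fun j _ => Finset.sum_comm
    rw [Finset.sum_congr rfl this]
    apply Finset.sum_sum_eq_zero_of_antisymm
    intro j l
    simp only [← Finset.sum_neg_distrib]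
    exact Finset.sum_congr rfl fun k _ => a₂ i j k l
  simp only [Finset.sum_union hST] at e₁ ⊢
  simp only [Finset.sum_add_distrib] at e₁ e₂ ⊢
  rw [e₁, zero_add, Finset.sum_eq_zero e₂, zero_add]

/-- The product of the generating polynomials of `A` and `B` in terms of the pairs of
complementary intervals of `A ⊔ B`. -/
theorem pairPoly_mul_pairPoly_eq_sum_cuts [Algebra ℚ K]
    (h₁ : ∀ i j k l, s i j * s k l = - (s k j * s i l))
    (h₂ : ∀ i j k l, s i j * s k l = - (s i l * s k j))
    {A B : Finset (Fin n)} (hAB : Disjoint A B)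
    (δ : Fin n → ℤ) (c₀ : ℤ) (hδ : ∑ p ∈ A ∪ B, δ p = 0)
    (hc : ∀ i ∈ A ∪ B, (if i ∈ A then 1 else 0) = c₀ + ∑ p ∈ A ∪ B with p ≤ i, δ p) :
    ∑ p ∈ A ∪ B, ∑ q ∈ A ∪ B with p < q, (-(δ p * δ q) : ℤ) •
        (pairPoly s ((A ∪ B).filter fun i => p ≤ i ∧ i < q) *
          pairPoly s ((A ∪ B).filter fun i => ¬ (p ≤ i ∧ i < q))) =
      pairPoly s A * pairPoly s B := by
  classical
  rw [pairPoly_mul_pairPoly_eq_quadratic s h₁ h₂ hAB]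
  rw [← sum_interval_cuts (A ∪ B) A Finset.subset_union_left
    (fun i j => ∑ k ∈ A ∪ B, ∑ l ∈ A ∪ B, twoPairTerm s (A ∪ B) i j k l) ?_ ?_ δ c₀ hδ hc]
  · refine Finset.sum_congr rfl fun p _ => Finset.sum_congr rfl fun q _ => ?_
    rw [pairPoly_mul_pairPoly_eq_quadratic s h₁ h₂ (Finset.disjoint_filter_filter_not _ _ _),
      Finset.filter_union_filter_not_eq]
  · intro j _
    apply Finset.sum_sum_eq_zero_of_antisymm
    intro i k
    rw [← Finset.sum_neg_distrib]
    exact Finset.sum_congr rfl fun l _ => twoPairTerm_swap_openers s h₁ _ i j k l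
  · intro i _
    have : ∀ j ∈ A ∪ B, ∑ k ∈ A ∪ B, ∑ l ∈ A ∪ B, twoPairTerm s (A ∪ B) i j k l =
        ∑ l ∈ A ∪ B, ∑ k ∈ A ∪ B, twoPairTerm s (A ∪ B) i j k l := fun j _ => Finset.sum_comm
    rw [Finset.sum_congr rfl this]
    apply Finset.sum_sum_eq_zero_of_antisymm
    intro j l
    rw [← Finset.sum_neg_distrib]
    exact Finset.sum_congr rfl fun k _ => twoPairTerm_swap_closers s h₂ _ i j k l

theorem pairPoly_eq_zero_of_card_le_one (h₀ : ∀ i, s i i = 0) {B : Finset (Fin n)}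
    (hB : B.card ≤ 1) : pairPoly s B = 0 := by
  refine Finset.sum_eq_zero fun i hi => Finset.sum_eq_zero fun j hj => ?_
  rw [Finset.card_le_one.1 hB i hi j hj, h₀, map_zero, zero_mul]

end PairPolynomial

/-! ### Jumps and maximal runs in a cyclic order. -/

section CyclicRuns

variable {n : ℕ}

/-- The cyclic predecessor of `x` in the ordered set `U`. -/
def prevIn (U : Finset (Fin n)) (x : Fin n) : Fin n :=
  if h : (U.filter (· < x)).Nonempty then (U.filter (· < x)).max' h
  else if h : U.Nonempty then U.max' h else x

/-- Either the predecessor is the largest smaller element, or there is no smaller element and it is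
the largest element. -/
theorem prevIn_spec {U : Finset (Fin n)} (hU : U.Nonempty) (x : Fin n) :
    prevIn U x ∈ U ∧
      ((prevIn U x < x ∧ ∀ y ∈ U, y < x → y ≤ prevIn U x) ∨
        ((∀ y ∈ U, x ≤ y) ∧ ∀ y ∈ U, y ≤ prevIn U x)) := by
  unfold prevIn
  split_ifs with h
  · have := Finset.max'_mem _ h
    rw [Finset.mem_filter] at this
    exact ⟨this.1, Or.inl ⟨this.2, fun y hy hyx =>
      Finset.le_max' _ _ (Finset.mem_filter.2 ⟨hy, hyx⟩)⟩⟩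
  · refine ⟨Finset.max'_mem _ hU, Or.inr ⟨fun y hy => ?_, fun y hy => Finset.le_max' _ _ hy⟩⟩
    by_contra hlt
    exact h ⟨y, Finset.mem_filter.2 ⟨hy, not_le.1 hlt⟩⟩

/-- The sum telescopes down to the least element of `U`, whose cyclic predecessor is the maximum;
this gives the boundary term. -/
theorem sum_sub_prevIn_lt {U : Finset (Fin n)} (hU : U.Nonempty) (f : Fin n → ℤ) (q : Fin n) :
    ∑ r ∈ U with r < q, (f r - f (prevIn U r)) = f (prevIn U q) - f (U.max' hU) := by
  induction q using WellFoundedLT.induction with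
  | ind q ih =>
    obtain ⟨hm, ⟨h1, h2⟩ | ⟨h1, h2⟩⟩ := prevIn_spec hU q
    · have : U.filter (· < q) = insert (prevIn U q) (U.filter (· < prevIn U q)) := by
        ext y
        simp only [Finset.mem_filter, Finset.mem_insert]
        constructor
        · rintro ⟨hy, hyq⟩
          rcases (h2 y hy hyq).eq_or_lt with h | h
          · exact Or.inl h
          · exact Or.inr ⟨hy, h⟩
        · rintro (rfl | ⟨hy, h⟩)
          · exact ⟨hm, h1⟩
          · exact ⟨hy, h.trans h1⟩
      rw [this, Finset.sum_insert (by simp), ih _ h1]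
      ring
    · have e : prevIn U q = U.max' hU :=
        le_antisymm (Finset.le_max' _ _ hm) (h2 _ (Finset.max'_mem _ hU))
      rw [e, sub_self, Finset.filter_false_of_mem fun y hy => not_lt.2 (h1 y hy), Finset.sum_empty]

theorem sum_sub_prevIn_le {U : Finset (Fin n)} (hU : U.Nonempty) (f : Fin n → ℤ) {q : Fin n}
    (hq : q ∈ U) :
    ∑ r ∈ U with r ≤ q, (f r - f (prevIn U r)) = f q - f (U.max' hU) := by
  have : U.filter (· ≤ q) = insert q (U.filter (· < q)) := by
    ext y
    simp only [Finset.mem_filter, Finset.mem_insert, le_iff_eq_or_lt]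
    constructor
    · rintro ⟨hy, rfl | h⟩
      · exact Or.inl rfl
      · exact Or.inr ⟨hy, h⟩
    · rintro (rfl | ⟨hy, h⟩)
      · exact ⟨hq, Or.inl rfl⟩
      · exact ⟨hy, Or.inr h⟩
  rw [this, Finset.sum_insert (by simp), sum_sub_prevIn_lt hU]
  ring

theorem sum_sub_prevIn {U : Finset (Fin n)} (f : Fin n → ℤ) :
    ∑ r ∈ U, (f r - f (prevIn U r)) = 0 := by
  rcases U.eq_empty_or_nonempty with rfl | hU
  · rfl
  · have := sum_sub_prevIn_le hU f (Finset.max'_mem U hU)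
    rwa [sub_self, Finset.filter_true_of_mem fun y hy => Finset.le_max' _ _ hy] at this

theorem sum_sub_prevIn_Ico {U : Finset (Fin n)} (hU : U.Nonempty) (f : Fin n → ℤ) {p q : Fin n}
    (hpq : p ≤ q) :
    ∑ r ∈ U with p ≤ r ∧ r < q, (f r - f (prevIn U r)) = f (prevIn U q) - f (prevIn U p) := by
  have h := sum_sub_prevIn_lt hU f q
  rw [← Finset.sum_filter_add_sum_filter_not (U.filter (· < q)) (· < p), Finset.filter_filter,
    Finset.filter_filter] at h
  have e1 : U.filter (fun a => a < q ∧ a < p) = U.filter (· < p) :=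
    Finset.filter_congr fun x _ => ⟨fun h => h.2, fun h => ⟨h.trans_le hpq, h⟩⟩
  have e2 : U.filter (fun a => a < q ∧ ¬ a < p) = U.filter (fun a => p ≤ a ∧ a < q) :=
    Finset.filter_congr fun x _ => by rw [not_lt, and_comm]
  rw [e1, e2, sum_sub_prevIn_lt hU] at h
  linarith

/-- The indicator of `A`. -/
def colour (A : Finset (Fin n)) (x : Fin n) : ℤ := if x ∈ A then 1 else 0

/-- The jump of the indicator of `A` at the element `x` of the cyclically ordered set `U`. -/
def jump (U A : Finset (Fin n)) (x : Fin n) : ℤ := colour A x - colour A (prevIn U x)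

theorem jump_ne_zero_iff {U A : Finset (Fin n)} {x : Fin n} :
    jump U A x ≠ 0 ↔ ¬ (x ∈ A ↔ prevIn U x ∈ A) := by
  unfold jump colour
  split_ifs <;> simp_all

theorem jump_cast_zmod (U A : Finset (Fin n)) (x : Fin n) :
    (jump U A x : ZMod 2) = if jump U A x ≠ 0 then 1 else 0 := by
  unfold jump colour
  split_ifs <;> simp_all

theorem jump_eq_zero_right {A B : Finset (Fin n)} (hAB : Disjoint A B) {x : Fin n}
    (hx : x ∈ A ∪ B) : jump (A ∪ B) B x = 0 ↔ jump (A ∪ B) A x = 0 := by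
  have key : ∀ y ∈ A ∪ B, (y ∈ B ↔ y ∉ A) := fun y hy =>
    ⟨fun h h' => Finset.disjoint_left.1 hAB h' h, fun h => (Finset.mem_union.1 hy).resolve_left h⟩
  rw [← not_iff_not, ← ne_eq, ← ne_eq, jump_ne_zero_iff, jump_ne_zero_iff, key x hx,
    key _ (prevIn_spec ⟨x, hx⟩ x).1]
  tauto

theorem mem_cyclicInterval {U : Finset (Fin n)} {i j x : Fin n} :
    x ∈ cyclicInterval U i j ↔
      x ∈ U ∧ ((i ≤ j ∧ i ≤ x ∧ x ≤ j) ∨ (j < i ∧ (i ≤ x ∨ x ≤ j))) := by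
  unfold cyclicInterval
  split_ifs with h
  · simp [h, h.not_gt]
  · simp [h, not_le.1 h]

/-- Going backwards, an interval can be left only at its starting point. -/
theorem prevIn_mem_cyclicInterval {U : Finset (Fin n)} {i j x : Fin n} (hi : i ∈ U)
    (hx : x ∈ cyclicInterval U i j) (hxi : x ≠ i) : prevIn U x ∈ cyclicInterval U i j := by
  rw [mem_cyclicInterval] at hx ⊢
  obtain ⟨hm, ⟨h1, h2⟩ | ⟨h1, h2⟩⟩ := prevIn_spec ⟨i, hi⟩ x
  · refine ⟨hm, ?_⟩
    have := h2 i hi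
    grind
  · refine ⟨hm, ?_⟩
    have := h1 i hi
    have := h2 i hi
    grind

theorem mem_maximalIntervals {U A P : Finset (Fin n)} :
    P ∈ maximalIntervals U A ↔ Maximal (fun D => IsCyclicInterval U D ∧ D ⊆ A) P := by
  classical
  rw [maximalIntervals, Finset.mem_filter, Finset.mem_powerset]
  exact ⟨fun h => h.2, fun h => ⟨h.prop.2, h⟩⟩

/-- A maximal interval begins at a jump and has no other jump. -/
theorem exists_of_mem_maximalIntervals {U A P : Finset (Fin n)} (hA : A ⊂ U)
    (hP : P ∈ maximalIntervals U A) :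
    P ⊆ A ∧ ∃ i ∈ U, ∃ j ∈ U, P = cyclicInterval U i j ∧ jump U A i ≠ 0 ∧
      ∀ x ∈ P, x ≠ i → jump U A x = 0 := by
  rw [mem_maximalIntervals] at hP
  obtain ⟨⟨⟨i, hi, j, hj, rfl⟩, hPA⟩, hmax⟩ := hP
  refine ⟨hPA, i, hi, j, hj, rfl, ?_, ?_⟩
  -- Without a jump at `i` the interval could be extended backwards to the predecessor `a`, against
  -- maximality. The element `y` outside `A` rules out that the interval is already all of `U`.
  · rw [jump_ne_zero_iff]
    intro hiff
    have hiP : i ∈ cyclicInterval U i j := by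
      rw [mem_cyclicInterval]; grind
    have hpA : prevIn U i ∈ A := hiff.1 (hPA hiP)
    obtain ⟨y, hyU, hyA⟩ := Finset.exists_of_ssubset hA
    have hy : y ∉ cyclicInterval U i j := fun h => hyA (hPA h)
    obtain ⟨hm, hspec⟩ := prevIn_spec ⟨i, hi⟩ i
    set a := prevIn U i
    have hsub : ∀ x ∈ cyclicInterval U a j, x = a ∨ x ∈ cyclicInterval U i j := by
      intro x hx
      rw [mem_cyclicInterval] at hx ⊢ hy
      have : x ≠ a → x ∈ U → x < i → a < i → x < a := by
        intro h1 h2 h3 h4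
        rcases hspec with h | h
        · exact lt_of_le_of_ne (h.2 x h2 h3) h1
        · exact absurd (h.1 x h2) (not_le.2 h3)
      rcases hspec with ⟨h1, h2⟩ | ⟨h1, h2⟩
      · have := h2 j hj
        have := h2 y hyU
        grind
      · have := h1 x
        have := h2 x
        have := h1 y hyU
        have := h2 y hyU
        have := h2 j hj
        have := h1 j hj
        grind
    have hle : cyclicInterval U i j ⊆ cyclicInterval U a j := by
      intro x hx
      rw [mem_cyclicInterval] at hx hy ⊢
      rcases hspec with ⟨h1, h2⟩ | ⟨h1, h2⟩
      · have := h2 j hj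
        have := h2 y hyU
        grind
      · have := h1 x
        have := h2 x
        have := h1 y hyU
        have := h2 y hyU
        have := h2 j hj
        have := h1 j hj
        grind
    have h3 : cyclicInterval U a j ⊆ cyclicInterval U i j := by
      refine hmax ⟨⟨a, hm, j, hj, rfl⟩, fun x hx => ?_⟩ hle
      rcases hsub x hx with rfl | h
      · exact hpA
      · exact hPA h
    have ha : a ∈ cyclicInterval U i j := h3 (by rw [mem_cyclicInterval]; grind)
    rw [mem_cyclicInterval] at ha hy
    rcases hspec with ⟨h1, h2⟩ | ⟨h1, h2⟩
    · have := h2 j hj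
      have := h2 y hyU
      grind
    · have := h1 y hyU
      have := h2 y hyU
      have := h2 j hj
      have := h1 j hj
      grind
  · intro x hx hxi
    by_contra h
    rw [← ne_eq, jump_ne_zero_iff] at h
    exact h (iff_of_true (hPA hx) (hPA (prevIn_mem_cyclicInterval hi hx hxi)))

theorem exists_mem_maximalIntervals {U A : Finset (Fin n)} (hA : A ⊆ U) {x : Fin n} (hx : x ∈ A) :
    ∃ P ∈ maximalIntervals U A, x ∈ P := by
  have hfin : {D : Finset (Fin n) | IsCyclicInterval U D ∧ D ⊆ A}.Finite := Set.toFinite _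
  have hmem : cyclicInterval U x x ∈ {D : Finset (Fin n) | IsCyclicInterval U D ∧ D ⊆ A} := by
    refine ⟨⟨x, hA hx, x, hA hx, rfl⟩, fun y hy => ?_⟩
    rw [mem_cyclicInterval] at hy
    have : y = x := by grind
    exact this ▸ hx
  obtain ⟨P, hle, hP⟩ := hfin.exists_le_maximal hmem
  refine ⟨P, mem_maximalIntervals.2 hP, hle ?_⟩
  rw [mem_cyclicInterval]
  exact ⟨hA hx, Or.inl ⟨le_rfl, le_rfl, le_rfl⟩⟩

/-- Of two cyclic intervals that meet, one contains the start of the other. A maximal interval has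
its only jump at its start, so the starts coincide; the intervals are then nested, hence equal. -/
theorem eq_of_mem_maximalIntervals {U A P Q : Finset (Fin n)} (hA : A ⊂ U)
    (hP : P ∈ maximalIntervals U A) (hQ : Q ∈ maximalIntervals U A) {x : Fin n}
    (hxP : x ∈ P) (hxQ : x ∈ Q) : P = Q := by
  obtain ⟨-, i, hi, j, hj, rfl, hi0, hi1⟩ := exists_of_mem_maximalIntervals hA hP
  obtain ⟨-, k, hk, l, hl, rfl, hk0, hk1⟩ := exists_of_mem_maximalIntervals hA hQ
  have hik : i = k := by
    by_contra hne
    have h1 : k ∉ cyclicInterval U i j := fun h => hk0 (hi1 k h (Ne.symm hne))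
    have h2 : i ∉ cyclicInterval U k l := fun h => hi0 (hk1 i h hne)
    rw [mem_cyclicInterval] at hxP hxQ h1 h2
    grind
  subst hik
  have mP := mem_maximalIntervals.1 hP
  have mQ := mem_maximalIntervals.1 hQ
  have : cyclicInterval U i j ⊆ cyclicInterval U i l ∨
      cyclicInterval U i l ⊆ cyclicInterval U i j := by
    by_cases h : (i ≤ j ∧ l < i) ∨ ((i ≤ j ↔ i ≤ l) ∧ j ≤ l)
    · left
      intro y hy
      rw [mem_cyclicInterval] at hy ⊢
      grind
    · right
      intro y hy
      rw [mem_cyclicInterval] at hy ⊢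
      grind
  rcases this with h | h
  · exact mP.eq_of_le mQ.prop h
  · exact (mQ.eq_of_le mP.prop h).symm

end CyclicRuns

/-! ### The coefficient of a cut as a product of two jumps. -/

section CutCoefficients

variable {n : ℕ} {A B : Finset (Fin n)}

theorem exists_of_mem_intervalPieces (hAB : Disjoint A B) (hA : A.Nonempty) (hB : B.Nonempty)
    {P : Finset (Fin n)} (hP : P ∈ intervalPieces A B) :
    ∃ i ∈ A ∪ B, ∃ j ∈ A ∪ B, P = cyclicInterval (A ∪ B) i j ∧ jump (A ∪ B) A i ≠ 0 ∧
      ∀ x ∈ P, x ≠ i → jump (A ∪ B) A x = 0 := by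
  have hA' : A ⊂ A ∪ B := Finset.subset_union_left.ssubset_of_ne fun h => by
    obtain ⟨b, hb⟩ := hB
    exact Finset.disjoint_left.1 hAB (h ▸ Finset.mem_union_right A hb) hb
  have hB' : B ⊂ A ∪ B := Finset.subset_union_right.ssubset_of_ne fun h => by
    obtain ⟨a, ha⟩ := hA
    exact Finset.disjoint_left.1 hAB ha (h ▸ Finset.mem_union_left B ha)
  rcases Finset.mem_union.1 hP with h | h
  · exact (exists_of_mem_maximalIntervals hA' h).2
  · obtain ⟨-, i, hi, j, hj, rfl, h0, h1⟩ := exists_of_mem_maximalIntervals hB' h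
    refine ⟨i, hi, j, hj, rfl, fun h => h0 ((jump_eq_zero_right hAB hi).2 h), fun x hx hxi => ?_⟩
    exact (jump_eq_zero_right hAB (mem_cyclicInterval.1 hx).1).1 (h1 x hx hxi)

theorem exists_mem_intervalPieces {x : Fin n} (hx : x ∈ A ∪ B) :
    ∃ P ∈ intervalPieces A B, x ∈ P := by
  rcases Finset.mem_union.1 hx with h | h
  · obtain ⟨P, hP, hxP⟩ := exists_mem_maximalIntervals (Finset.subset_union_left (s₂ := B)) h
    exact ⟨P, Finset.mem_union_left _ hP, hxP⟩
  · obtain ⟨P, hP, hxP⟩ := exists_mem_maximalIntervals (Finset.subset_union_right (s₁ := A)) h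
    exact ⟨P, Finset.mem_union_right _ hP, hxP⟩

theorem eq_of_mem_intervalPieces (hAB : Disjoint A B) (hA : A.Nonempty) (hB : B.Nonempty)
    {P Q : Finset (Fin n)} (hP : P ∈ intervalPieces A B) (hQ : Q ∈ intervalPieces A B) {x : Fin n}
    (hxP : x ∈ P) (hxQ : x ∈ Q) : P = Q := by
  have hA' : A ⊂ A ∪ B := Finset.subset_union_left.ssubset_of_ne fun h => by
    obtain ⟨b, hb⟩ := hB
    exact Finset.disjoint_left.1 hAB (h ▸ Finset.mem_union_right A hb) hb
  have hB' : B ⊂ A ∪ B := Finset.subset_union_right.ssubset_of_ne fun h => by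
    obtain ⟨a, ha⟩ := hA
    exact Finset.disjoint_left.1 hAB ha (h ▸ Finset.mem_union_left B ha)
  rcases Finset.mem_union.1 hP with h | h <;> rcases Finset.mem_union.1 hQ with h' | h'
  · exact eq_of_mem_maximalIntervals hA' h h' hxP hxQ
  · exact absurd ((mem_maximalIntervals.1 h').prop.2 hxQ)
      (Finset.disjoint_left.1 hAB ((mem_maximalIntervals.1 h).prop.2 hxP))
  · exact absurd ((mem_maximalIntervals.1 h).prop.2 hxP)
      (Finset.disjoint_left.1 hAB ((mem_maximalIntervals.1 h').prop.2 hxQ))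
  · exact eq_of_mem_maximalIntervals hB' h h' hxP hxQ

/-- The number of pieces in a union of pieces is the number of its jumps. -/
theorem card_eq_card_jumps (hAB : Disjoint A B) (hA : A.Nonempty) (hB : B.Nonempty)
    {F : Finset (Finset (Fin n))} (hF : F ⊆ intervalPieces A B) {T : Finset (Fin n)}
    (hT : F.biUnion id = T) : F.card = (T.filter fun x => jump (A ∪ B) A x ≠ 0).card := by
  rw [← hT, Finset.filter_biUnion, Finset.card_biUnion, Finset.card_eq_sum_ones]
  · refine Finset.sum_congr rfl fun P hP => ?_
    obtain ⟨i, hi, j, hj, rfl, h0, h1⟩ := exists_of_mem_intervalPieces hAB hA hB (hF hP)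
    symm
    rw [Finset.card_eq_one]
    refine ⟨i, Finset.ext fun x => ?_⟩
    rw [Finset.mem_filter, Finset.mem_singleton]
    constructor
    · rintro ⟨hx, hx0⟩
      by_contra hne
      exact hx0 (h1 x hx hne)
    · rintro rfl
      refine ⟨?_, h0⟩
      rw [id, mem_cyclicInterval]
      grind
  · intro P hP Q hQ hPQ
    rw [Function.onFun, Finset.disjoint_left]
    intro x hx hx'
    exact hPQ (eq_of_mem_intervalPieces hAB hA hB (hF hP) (hF hQ) (Finset.mem_filter.1 hx).1
      (Finset.mem_filter.1 hx').1)

theorem exists_biUnion_eq {T : Finset (Fin n)} (hT : T ⊆ A ∪ B)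
    (h : ∀ P ∈ intervalPieces A B, ∀ x ∈ P, x ∈ T → P ⊆ T) :
    ∃ F ⊆ intervalPieces A B, F.biUnion id = T := by
  refine ⟨(intervalPieces A B).filter (· ⊆ T), Finset.filter_subset _ _, ?_⟩
  ext x
  simp only [Finset.mem_biUnion, Finset.mem_filter, id]
  constructor
  · rintro ⟨P, ⟨-, hP⟩, hx⟩
    exact hP hx
  · intro hx
    obtain ⟨P, hP, hxP⟩ := exists_mem_intervalPieces (hT hx)
    exact ⟨P, ⟨hP, h P hP x hxP hx⟩, hxP⟩

/-- An interval cut out at two jumps is a union of pieces. -/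
theorem piece_subset_interval (hAB : Disjoint A B) (hA : A.Nonempty) (hB : B.Nonempty)
    {p q : Fin n} (hp : p ∈ A ∪ B) (hq : q ∈ A ∪ B)
    (hjp : jump (A ∪ B) A p ≠ 0) (hjq : jump (A ∪ B) A q ≠ 0)
    {P : Finset (Fin n)} (hP : P ∈ intervalPieces A B) {x y : Fin n} (hx : x ∈ P) (hy : y ∈ P)
    (hxT : p ≤ x ∧ x < q) : p ≤ y ∧ y < q := by
  obtain ⟨i, hi, j, hj, rfl, h0, h1⟩ := exists_of_mem_intervalPieces hAB hA hB hP
  -- A piece on both sides of the cut would contain `p` or `q` beyond its starting point, where it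
  -- has no jump.
  have h2 := h1 p
  have h3 := h1 q
  rw [mem_cyclicInterval] at hx hy h2 h3
  grind

/-- If the two parts of a cut are unions of pieces, then the cut is at two jumps. -/
theorem jump_ne_zero_of_biUnion_eq (hAB : Disjoint A B) (hA : A.Nonempty) (hB : B.Nonempty)
    {p q : Fin n} (hp : p ∈ A ∪ B) (hq : q ∈ A ∪ B) (hpq : p < q)
    {F F' : Finset (Finset (Fin n))} (hF : F ⊆ intervalPieces A B) (hF' : F' ⊆ intervalPieces A B)
    (hT : F.biUnion id = (A ∪ B).filter fun i => p ≤ i ∧ i < q)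
    (hS : F'.biUnion id = (A ∪ B).filter fun i => ¬ (p ≤ i ∧ i < q)) :
    jump (A ∪ B) A p ≠ 0 ∧ jump (A ∪ B) A q ≠ 0 := by
  have hpT : p ∈ F.biUnion id := by rw [hT]; grind
  have hqS : q ∈ F'.biUnion id := by rw [hS]; grind
  rw [Finset.mem_biUnion] at hpT hqS
  obtain ⟨P, hPF, hpP⟩ := hpT
  obtain ⟨Q, hQF, hqQ⟩ := hqS
  have hPT : ∀ x ∈ P, p ≤ x ∧ x < q := fun x hx => by
    have : x ∈ F.biUnion id := Finset.mem_biUnion.2 ⟨P, hPF, hx⟩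
    rw [hT] at this
    exact (Finset.mem_filter.1 this).2
  have hQS : ∀ x ∈ Q, ¬ (p ≤ x ∧ x < q) := fun x hx => by
    have : x ∈ F'.biUnion id := Finset.mem_biUnion.2 ⟨Q, hQF, hx⟩
    rw [hS] at this
    exact (Finset.mem_filter.1 this).2
  constructor
  · obtain ⟨i, hi, j, hj, rfl, h0, h1⟩ := exists_of_mem_intervalPieces hAB hA hB (hF hPF)
    -- A piece starting elsewhere in `[p, q)` would have to pass `q` before coming round to `p`. The
    -- argument for `q` is the same with the two arcs exchanged.
    intro h
    have hpi : p ≠ i := fun e => h0 (e ▸ h)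
    have h2 := hPT i
    have h3 := hPT q
    simp only [id] at hpP
    rw [mem_cyclicInterval] at hpP h2 h3
    grind
  · obtain ⟨i, hi, j, hj, rfl, h0, h1⟩ := exists_of_mem_intervalPieces hAB hA hB (hF' hQF)
    intro h
    have hqi : q ≠ i := fun e => h0 (e ▸ h)
    have h2 := hQS i
    have h3 := hQS p
    simp only [id] at hqQ
    rw [mem_cyclicInterval] at hqQ h2 h3
    grind

theorem card_jumps_cast (U A T : Finset (Fin n)) :
    ((T.filter fun x => jump U A x ≠ 0).card : ZMod 2) = ((∑ x ∈ T, jump U A x : ℤ) : ZMod 2) := by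
  rw [Int.cast_sum, Finset.card_filter, Nat.cast_sum]
  refine Finset.sum_congr rfl fun x _ => ?_
  rw [jump_cast_zmod]
  split_ifs <;> simp

theorem resolutionCoeff_pair {T S : Block n} (hT : 2 ≤ T.1.card) (hS : 2 ≤ S.1.card) :
    resolutionCoeff A B {T, S} =
      open Classical in
      if IsOddUnion A B T.1 ∧ IsOddUnion A B S.1 then 1
      else if IsEvenUnion A B T.1 ∧ IsEvenUnion A B S.1 then -1 else 0 := by
  unfold resolutionCoeff
  have h : ¬ ∃ X ∈ ({T, S} : Finset (Block n)), X.1.card < 2 := by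
    rintro ⟨X, hX, h⟩
    rw [Finset.mem_insert, Finset.mem_singleton] at hX
    rcases hX with rfl | rfl <;> omega
  rw [if_neg h]
  have e (f : Finset (Fin n) → Prop) :
      (∀ X ∈ ({T, S} : Finset (Block n)), f X.1) ↔ f T.1 ∧ f S.1 := by
    simp
  classical
  rw [if_congr (e (IsOddUnion A B)) rfl (if_congr (e (IsEvenUnion A B)) rfl rfl)]

/-- The coefficient of the pair of blocks cut out at `p` and `q`. -/
theorem resolutionCoeff_cut (hAB : Disjoint A B) (hA : A.Nonempty) (hB : B.Nonempty)
    {p q : Fin n} (hp : p ∈ A ∪ B) (hq : q ∈ A ∪ B) (hpq : p < q) {T S : Block n}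
    (hT : T.1 = (A ∪ B).filter fun i => p ≤ i ∧ i < q)
    (hS : S.1 = (A ∪ B).filter fun i => ¬ (p ≤ i ∧ i < q))
    (hT2 : 2 ≤ T.1.card) (hS2 : 2 ≤ S.1.card) :
    resolutionCoeff A B {T, S} = - (jump (A ∪ B) A p * jump (A ∪ B) A q) := by
  rw [resolutionCoeff_pair hT2 hS2]
  by_cases hj : jump (A ∪ B) A p ≠ 0 ∧ jump (A ∪ B) A q ≠ 0
  · obtain ⟨hjp, hjq⟩ := hj
    obtain ⟨F, hF, hFT⟩ := exists_biUnion_eq (A := A) (B := B) (T := T.1)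
      (by rw [hT]; exact Finset.filter_subset _ _) (by
        intro P hP x hx hxT y hy
        rw [hT, Finset.mem_filter] at hxT ⊢
        refine ⟨?_, piece_subset_interval hAB hA hB hp hq hjp hjq hP hx hy hxT.2⟩
        obtain ⟨i, -, j, -, rfl, -⟩ := exists_of_mem_intervalPieces hAB hA hB hP
        exact (mem_cyclicInterval.1 hy).1)
    obtain ⟨F', hF', hFS⟩ := exists_biUnion_eq (A := A) (B := B) (T := S.1)
      (by rw [hS]; exact Finset.filter_subset _ _) (by
        intro P hP x hx hxT y hy
        rw [hS, Finset.mem_filter] at hxT ⊢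
        refine ⟨?_, fun h => hxT.2 (piece_subset_interval hAB hA hB hp hq hjp hjq hP hy hx h)⟩
        obtain ⟨i, -, j, -, rfl, -⟩ := exists_of_mem_intervalPieces hAB hA hB hP
        exact (mem_cyclicInterval.1 hy).1)
    -- The parity of the number of pieces is that of the sum of their jumps. All jumps together sum
    -- to zero, so both blocks have the same parity.
    have cT : ∀ E ⊆ intervalPieces A B, E.biUnion id = T.1 →
        (E.card : ZMod 2) = ((∑ x ∈ T.1, jump (A ∪ B) A x : ℤ) : ZMod 2) := fun E hE h => by
      rw [card_eq_card_jumps hAB hA hB hE h, card_jumps_cast]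
    have cS : ∀ E ⊆ intervalPieces A B, E.biUnion id = S.1 →
        (E.card : ZMod 2) = ((∑ x ∈ T.1, jump (A ∪ B) A x : ℤ) : ZMod 2) := fun E hE h => by
      rw [card_eq_card_jumps hAB hA hB hE h, card_jumps_cast]
      have htot := sum_sub_prevIn (U := A ∪ B) (colour A)
      rw [← Finset.sum_filter_add_sum_filter_not _ (fun i => p ≤ i ∧ i < q), ← hT, ← hS] at htot
      change ∑ x ∈ T.1, jump (A ∪ B) A x + ∑ x ∈ S.1, jump (A ∪ B) A x = 0 at htot
      have := eq_neg_of_add_eq_zero_right htot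
      rw [this, Int.cast_neg, ZMod.neg_eq_self_mod_two]
    have hsum : ∑ x ∈ T.1, jump (A ∪ B) A x =
        colour A (prevIn (A ∪ B) q) - colour A (prevIn (A ∪ B) p) := by
      rw [hT]
      exact sum_sub_prevIn_Ico ⟨p, hp⟩ (colour A) hpq.le
    have par : ∀ E : Finset (Finset (Fin n)), (Even E.card ↔ (E.card : ZMod 2) = 0) := fun E =>
      (ZMod.natCast_eq_zero_iff_even).symm
    have evenT : IsEvenUnion A B T.1 ↔ Even (∑ x ∈ T.1, jump (A ∪ B) A x) := by
      rw [← ZMod.intCast_eq_zero_iff_even]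
      constructor
      · rintro ⟨E, hE, hev, h⟩
        rw [← cT E hE h, ← par]; exact hev
      · intro h
        exact ⟨F, hF, by rw [par, cT F hF hFT, h], hFT⟩
    have oddT : IsOddUnion A B T.1 ↔ ¬ Even (∑ x ∈ T.1, jump (A ∪ B) A x) := by
      rw [← ZMod.intCast_eq_zero_iff_even]
      constructor
      · rintro ⟨E, hE, hev, h⟩
        rw [← cT E hE h, ← par, Nat.not_even_iff_odd]; exact hev
      · intro h
        exact ⟨F, hF, by rw [← Nat.not_even_iff_odd, par, cT F hF hFT]; exact h, hFT⟩
    have evenS : IsEvenUnion A B S.1 ↔ Even (∑ x ∈ T.1, jump (A ∪ B) A x) := by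
      rw [← ZMod.intCast_eq_zero_iff_even]
      constructor
      · rintro ⟨E, hE, hev, h⟩
        rw [← cS E hE h, ← par]; exact hev
      · intro h
        exact ⟨F', hF', by rw [par, cS F' hF' hFS, h], hFS⟩
    have oddS : IsOddUnion A B S.1 ↔ ¬ Even (∑ x ∈ T.1, jump (A ∪ B) A x) := by
      rw [← ZMod.intCast_eq_zero_iff_even]
      constructor
      · rintro ⟨E, hE, hev, h⟩
        rw [← cS E hE h, ← par, Nat.not_even_iff_odd]; exact hev
      · intro h
        exact ⟨F', hF', by rw [← Nat.not_even_iff_odd, par, cS F' hF' hFS]; exact h, hFS⟩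
    simp only [evenT, oddT, evenS, oddS, and_self]
    -- Both jumps are `±1`. The sum is even exactly if the colours before `p` and before `q` agree,
    -- that is, if the two jumps are equal.
    rw [hsum]
    have hc : ∀ x, colour A x = 0 ∨ colour A x = 1 := fun x => by
      unfold colour; split_ifs <;> simp
    unfold jump at hjp hjq ⊢
    clear evenT evenS oddT oddS hsum cT cS par
    have h1 := hc p
    have h2 := hc q
    have h3 := hc (prevIn (A ∪ B) p)
    have h4 := hc (prevIn (A ∪ B) q)
    generalize colour A p = a at *
    generalize colour A q = b at *
    generalize colour A (prevIn (A ∪ B) p) = c at *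
    generalize colour A (prevIn (A ∪ B) q) = d at *
    rcases h3 with rfl | rfl <;> rcases h4 with rfl | rfl <;> rcases h1 with rfl | rfl <;>
      rcases h2 with rfl | rfl <;>
      first
        | exact absurd (sub_self _) hjp
        | exact absurd (sub_self _) hjq
        | norm_num
  · have hz : jump (A ∪ B) A p * jump (A ∪ B) A q = 0 := by
      rw [not_and_or, not_not, not_not] at hj
      exact mul_eq_zero.2 hj
    rw [if_neg, if_neg, hz, neg_zero]
    · rintro ⟨⟨F, hF, -, hFT⟩, ⟨F', hF', -, hFS⟩⟩
      exact hj (jump_ne_zero_of_biUnion_eq hAB hA hB hp hq hpq hF hF' (hFT.trans hT)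
        (hFS.trans hS))
    · rintro ⟨⟨F, hF, -, hFT⟩, ⟨F', hF', -, hFS⟩⟩
      exact hj (jump_ne_zero_of_biUnion_eq hAB hA hB hp hq hpq hF hF' (hFT.trans hT)
        (hFS.trans hS))

end CutCoefficients

/-! ### Noncrossing two-block partitions as cuts. -/

section NoncrossingPairs

variable {n : ℕ}

theorem Crosses.symm {A B : Finset (Fin n)} (h : Crosses A B) : Crosses B A := by
  obtain ⟨a, b, c, d, hab, hbc, hcd, h | h⟩ := h
  · exact ⟨a, b, c, d, hab, hbc, hcd, Or.inr h⟩
  · exact ⟨a, b, c, d, hab, hbc, hcd, Or.inl h⟩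

theorem crosses_comm {A B : Finset (Fin n)} : Crosses A B ↔ Crosses B A :=
  ⟨Crosses.symm, Crosses.symm⟩

theorem Crosses.two_le_card {A B : Finset (Fin n)} (h : Crosses A B) : 2 ≤ A.card := by
  obtain ⟨a, b, c, d, hab, hbc, hcd, h | h⟩ := h
  · exact Finset.one_lt_card.2 ⟨a, h.1, c, h.2.1, (hab.trans hbc).ne⟩
  · exact Finset.one_lt_card.2 ⟨b, h.2.2.1, d, h.2.2.2, (hbc.trans hcd).ne⟩

theorem isNoncrossingFamily_pair {T S : Block n} (hd : Disjoint T.1 S.1)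
    (hc : ¬ Crosses T.1 S.1) : IsNoncrossingFamily {T, S} := by
  intro X hX Y hY hXY
  rw [Finset.mem_insert, Finset.mem_singleton] at hX hY
  rcases hX with rfl | rfl <;> rcases hY with rfl | rfl
  · exact absurd rfl hXY
  · exact ⟨hd, hc⟩
  · exact ⟨hd.symm, fun h => hc h.symm⟩
  · exact absurd rfl hXY

theorem mem_twoBlockNoncrossing {U : Finset (Fin n)} {P : Finset (Block n)} :
    P ∈ twoBlockNoncrossing U ↔
      P.card = 2 ∧ IsNoncrossingFamily P ∧ P.biUnion (fun S => S.1) = U := by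
  classical
  simp [twoBlockNoncrossing]

theorem cut_ne {U : Finset (Fin n)} {p q : Fin n} (hp : p ∈ U) (hpq : p < q) {T S : Block n}
    (hT : T.1 = U.filter fun i => p ≤ i ∧ i < q)
    (hS : S.1 = U.filter fun i => ¬ (p ≤ i ∧ i < q)) : T ≠ S := by
  rintro rfl
  have h1 : p ∈ T.1 := by rw [hT]; grind
  have h2 : p ∉ T.1 := by rw [hS]; grind
  exact h2 h1

theorem cut_mem_twoBlockNoncrossing {U : Finset (Fin n)} {p q : Fin n} (hp : p ∈ U) (hpq : p < q)
    {T S : Block n} (hT : T.1 = U.filter fun i => p ≤ i ∧ i < q)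
    (hS : S.1 = U.filter fun i => ¬ (p ≤ i ∧ i < q)) : {T, S} ∈ twoBlockNoncrossing U := by
  refine mem_twoBlockNoncrossing.2 ⟨Finset.card_pair (cut_ne hp hpq hT hS),
    isNoncrossingFamily_pair ?_ ?_, ?_⟩
  · rw [hT, hS]
    exact Finset.disjoint_filter_filter_not _ _ _
  · rw [hT, hS]
    rintro ⟨a, b, c, d, hab, hbc, hcd, h⟩
    simp only [Finset.mem_filter] at h
    grind
  · rw [Finset.biUnion_insert, Finset.singleton_biUnion, hT, hS, Finset.filter_union_filter_not_eq]

/-- As the minimum lies in `Y`, no element of `Y` lies between the ends of `X`. If `Y` continues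
after `X`, then `X` is cut out by its minimum and the next element of `Y`; otherwise `Y` is an
initial segment and is itself the interval of the cut. -/
theorem exists_cut_of_min_mem {X Y : Block n} (hd : Disjoint X.1 Y.1) (hc : ¬ Crosses X.1 Y.1)
    {m : Fin n} (hm : ∀ y ∈ X.1 ∪ Y.1, m ≤ y) (hmY : m ∈ Y.1) :
    ∃ p ∈ X.1 ∪ Y.1, ∃ q ∈ X.1 ∪ Y.1, p < q ∧ ∃ T S : Block n,
      T.1 = (X.1 ∪ Y.1).filter (fun i => p ≤ i ∧ i < q) ∧
      S.1 = (X.1 ∪ Y.1).filter (fun i => ¬ (p ≤ i ∧ i < q)) ∧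
      ({X, Y} : Finset (Block n)) = {T, S} := by
  have hx := X.1.min'_mem X.2
  have hx' := X.1.max'_mem X.2
  have hle := fun y hy => X.1.min'_le y hy
  have hle' := fun y hy => X.1.le_max' y hy
  set x := X.1.min' X.2
  set x' := X.1.max' X.2
  have hdis : ∀ y, y ∈ X.1 → y ∉ Y.1 := fun y hy => Finset.disjoint_left.1 hd hy
  have hmx : m < x := lt_of_le_of_ne (hm x (Finset.mem_union_left _ hx))
    fun h => hdis x hx (h ▸ hmY)
  have hbetween : ∀ y ∈ Y.1, x < y → y < x' → False := fun y hy h1 h2 =>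
    hc ⟨m, x, y, x', hmx, h1, h2, Or.inr ⟨hmY, hy, hx, hx'⟩⟩
  by_cases hex : (Y.1.filter (x' < ·)).Nonempty
  · have hq := Finset.min'_mem _ hex
    have hqle := fun y hy => Finset.min'_le (Y.1.filter (x' < ·)) y hy
    set q := (Y.1.filter (x' < ·)).min' hex
    rw [Finset.mem_filter] at hq
    have key : ∀ y ∈ X.1 ∪ Y.1, (x ≤ y ∧ y < q) ↔ y ∈ X.1 := by
      intro y hy
      constructor
      · rintro ⟨h1, h2⟩
        by_contra hyX
        have hyY := (Finset.mem_union.1 hy).resolve_left hyX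
        have h3 : x < y := lt_of_le_of_ne h1 fun e => hyX (e ▸ hx)
        rcases lt_trichotomy y x' with h | h | h
        · exact hbetween y hyY h3 h
        · exact hyX (h ▸ hx')
        · exact absurd (hqle y (Finset.mem_filter.2 ⟨hyY, h⟩)) (not_le.2 h2)
      · intro h
        exact ⟨hle y h, (hle' y h).trans_lt hq.2⟩
    refine ⟨x, Finset.mem_union_left _ hx, q, Finset.mem_union_right _ hq.1,
      (hle x' hx').trans_lt hq.2, X, Y, ?_, ?_, rfl⟩
    · ext y
      have := key y
      grind
    · ext y
      have := key y
      have := hdis y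
      grind
  · have key : ∀ y ∈ X.1 ∪ Y.1, (m ≤ y ∧ y < x) ↔ y ∈ Y.1 := by
      intro y hy
      constructor
      · rintro ⟨h1, h2⟩
        by_contra hyY
        have hyX := (Finset.mem_union.1 hy).resolve_right hyY
        exact absurd (hle y hyX) (not_le.2 h2)
      · intro h
        refine ⟨hm y hy, ?_⟩
        by_contra h2
        have h3 : x < y := lt_of_le_of_ne (not_lt.1 h2) fun e => hdis x hx (e ▸ h)
        rcases lt_trichotomy y x' with h' | h' | h'
        · exact hbetween y h h3 h'
        · exact hdis x' hx' (h' ▸ h)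
        · exact hex ⟨y, Finset.mem_filter.2 ⟨h, h'⟩⟩
    refine ⟨m, Finset.mem_union_right _ hmY, x, Finset.mem_union_left _ hx, hmx, Y, X, ?_, ?_,
      Finset.pair_comm _ _⟩
    · ext y
      have := key y
      grind
    · ext y
      have := key y
      have := hdis y
      grind

/-- Every noncrossing partition into two blocks is given by a cut. -/
theorem exists_cut {U : Finset (Fin n)} {P : Finset (Block n)} (hP : P ∈ twoBlockNoncrossing U) :
    ∃ p ∈ U, ∃ q ∈ U, p < q ∧ ∃ T S : Block n, T.1 = U.filter (fun i => p ≤ i ∧ i < q) ∧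
      S.1 = U.filter (fun i => ¬ (p ≤ i ∧ i < q)) ∧ P = {T, S} := by
  obtain ⟨h2, hnc, hU⟩ := mem_twoBlockNoncrossing.1 hP
  obtain ⟨X, Y, hXY, rfl⟩ := Finset.card_eq_two.1 h2
  obtain ⟨hd, hc⟩ := hnc X (by simp) Y (by simp) hXY
  rw [Finset.biUnion_insert, Finset.singleton_biUnion] at hU
  have hne : (X.1 ∪ Y.1).Nonempty := X.2.mono Finset.subset_union_left
  have hm := Finset.min'_mem _ hne
  have hle := fun y hy => Finset.min'_le (X.1 ∪ Y.1) y hy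
  rcases Finset.mem_union.1 hm with h | h
  · rw [Finset.union_comm] at hU
    have := exists_cut_of_min_mem (X := Y) (Y := X) hd.symm (fun h => hc h.symm)
      (m := (X.1 ∪ Y.1).min' hne) (fun y hy => hle y (by rwa [Finset.union_comm])) h
    rw [hU, Finset.pair_comm] at this
    exact this
  · have := exists_cut_of_min_mem hd hc hle h
    rw [hU] at this
    exact this

theorem cut_injective {U : Finset (Fin n)} {p q p' q' : Fin n} (hp : p ∈ U) (hq : q ∈ U)
    (hp' : p' ∈ U) (hq' : q' ∈ U) (hpq : p < q) (hpq' : p' < q') {T S T' S' : Block n}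
    (hT : T.1 = U.filter fun i => p ≤ i ∧ i < q)
    (hT' : T'.1 = U.filter fun i => p' ≤ i ∧ i < q')
    (hS' : S'.1 = U.filter fun i => ¬ (p' ≤ i ∧ i < q'))
    (h : ({T, S} : Finset (Block n)) = {T', S'}) : p = p' ∧ q = q' := by
  have hmem : T ∈ ({T', S'} : Finset (Block n)) := h ▸ Finset.mem_insert_self _ _
  rw [Finset.mem_insert, Finset.mem_singleton] at hmem
  have key : (∀ i ∈ U, (p ≤ i ∧ i < q) ↔ (p' ≤ i ∧ i < q')) ∨
      (∀ i ∈ U, (p ≤ i ∧ i < q) ↔ ¬ (p' ≤ i ∧ i < q')) := by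
    rcases hmem with rfl | rfl
    · left
      intro i hi
      have := Finset.ext_iff.1 (hT.symm.trans hT') i
      simpa [hi] using this
    · right
      intro i hi
      have := Finset.ext_iff.1 (hT.symm.trans hS') i
      rw [Finset.mem_filter, Finset.mem_filter] at this
      simpa only [hi, true_and] using this
  rcases key with key | key
  · have h1 := key p hp
    have h2 := key p' hp'
    have h3 := key q hq
    have h4 := key q' hq'
    constructor <;> grind
  -- Complementary intervals are impossible: the larger of `q` and `q'` lies in neither.
  · have h1 := key p hp
    have h2 := key p' hp'
    have h3 := key q hq
    have h4 := key q' hq'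
    grind

/-- A cut at `p < q` separates `p` from `q`, so both blocks are nonempty, and every partition arises
from exactly one such pair. -/
theorem sum_twoBlockNoncrossing {M : Type*} [AddCommMonoid M] (U : Finset (Fin n))
    (f : Finset (Block n) → M) (g : Fin n → Fin n → M)
    (h : ∀ p ∈ U, ∀ q ∈ U, p < q → ∀ T S : Block n, T.1 = U.filter (fun i => p ≤ i ∧ i < q) →
      S.1 = U.filter (fun i => ¬ (p ≤ i ∧ i < q)) → f {T, S} = g p q) :
    ∑ P ∈ twoBlockNoncrossing U, f P = ∑ p ∈ U, ∑ q ∈ U with p < q, g p q := by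
  classical
  have blocks : ∀ a : (Σ _ : Fin n, Fin n), a ∈ U.sigma (fun p => U.filter (p < ·)) →
      ∃ T S : Block n, T.1 = U.filter (fun i => a.1 ≤ i ∧ i < a.2) ∧
        S.1 = U.filter (fun i => ¬ (a.1 ≤ i ∧ i < a.2)) := by
    rintro ⟨p, q⟩ ha
    rw [Finset.mem_sigma, Finset.mem_filter] at ha
    exact ⟨⟨_, p, Finset.mem_filter.2 ⟨ha.1, le_rfl, ha.2.2⟩⟩,
      ⟨_, q, Finset.mem_filter.2 ⟨ha.2.1, fun h => lt_irrefl _ h.2⟩⟩, rfl, rfl⟩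
  choose T S hT hS using blocks
  rw [Finset.sum_sigma']
  symm
  refine Finset.sum_bij (fun a ha => {T a ha, S a ha}) ?_ ?_ ?_ ?_
  · intro a ha
    have ha' := ha
    rw [Finset.mem_sigma, Finset.mem_filter] at ha'
    exact cut_mem_twoBlockNoncrossing ha'.1 ha'.2.2 (hT a ha) (hS a ha)
  · intro a ha b hb hab
    have ha' := ha
    have hb' := hb
    rw [Finset.mem_sigma, Finset.mem_filter] at ha' hb'
    obtain ⟨h1, h2⟩ := cut_injective ha'.1 ha'.2.1 hb'.1 hb'.2.1 ha'.2.2 hb'.2.2 (hT a ha)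
      (hT b hb) (hS b hb) hab
    exact Sigma.ext h1 (heq_of_eq h2)
  · intro P hP
    obtain ⟨p, hp, q, hq, hpq, T', S', hT', hS', rfl⟩ := exists_cut hP
    have ha : (⟨p, q⟩ : Σ _ : Fin n, Fin n) ∈ U.sigma (fun p => U.filter (p < ·)) :=
      Finset.mem_sigma.2 ⟨hp, Finset.mem_filter.2 ⟨hq, hpq⟩⟩
    refine ⟨⟨p, q⟩, ha, ?_⟩
    rw [Subtype.ext ((hT _ ha).trans hT'.symm), Subtype.ext ((hS _ ha).trans hS'.symm)]
  · intro a ha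
    have ha' := ha
    rw [Finset.mem_sigma, Finset.mem_filter] at ha'
    exact (h _ ha'.1 _ ha'.2.1 ha'.2.2 _ _ (hT a ha) (hS a ha)).symm

end NoncrossingPairs

/-! ### The crossing relations hold in the model. -/

section Model

variable {n : ℕ} {K : Type*} [CommRing K] (s : Fin n → Fin n → K)

/-- The image of the variable `y_B` in the polynomial model. -/
noncomputable def blockPoly (B : Block n) : MvPolynomial (Fin 4 × Fin n) K :=
  if B.1.card = 1 then ∏ k ∈ B.1, MvPolynomial.X (3, k) else pairPoly s B.1

theorem blockPoly_of_two_le {B : Block n} (hB : 2 ≤ B.1.card) : blockPoly s B = pairPoly s B.1 :=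
  if_neg (by omega)

theorem aeval_blockMonomial [Algebra ℂ K] (P : Finset (Block n)) :
    MvPolynomial.aeval (blockPoly s) (blockMonomial P) = ∏ B ∈ P, blockPoly s B := by
  simp [blockMonomial, map_prod]

/-- The cut formula is applied to the jumps of the indicator of `A`. Its constant is the colour of
the last element, against which the jump at the first one is measured. -/
theorem aeval_crossingRelation [Algebra ℂ K] (h₀ : ∀ i, s i i = 0)
    (h₁ : ∀ i j k l, s i j * s k l = - (s k j * s i l))
    (h₂ : ∀ i j k l, s i j * s k l = - (s i l * s k j))
    {A B : Block n} (hd : Disjoint A.1 B.1) (hc : Crosses A.1 B.1) :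
    MvPolynomial.aeval (blockPoly s) (crossingRelation A B) = 0 := by
  let _ : Algebra ℚ K := ((algebraMap ℂ K).comp (algebraMap ℚ ℂ)).toAlgebra
  rw [crossingRelation, map_sub, map_mul, MvPolynomial.aeval_X, MvPolynomial.aeval_X,
    blockPoly_of_two_le s hc.two_le_card, blockPoly_of_two_le s hc.symm.two_le_card, map_sum,
    sub_eq_zero]
  have hU : (A.1 ∪ B.1).Nonempty := A.2.mono Finset.subset_union_left
  rw [← pairPoly_mul_pairPoly_eq_sum_cuts s h₁ h₂ hd (jump (A.1 ∪ B.1) A.1)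
    (colour A.1 ((A.1 ∪ B.1).max' hU)) (sum_sub_prevIn _)]
  · symm
    apply sum_twoBlockNoncrossing
    intro p hp q hq hpq T S hT hS
    rw [map_zsmul, aeval_blockMonomial, Finset.prod_pair (cut_ne hp hpq hT hS), ← hT, ← hS]
    by_cases hcard : 2 ≤ T.1.card ∧ 2 ≤ S.1.card
    · rw [resolutionCoeff_cut hd A.2 B.2 hp hq hpq hT hS hcard.1 hcard.2,
        blockPoly_of_two_le s hcard.1, blockPoly_of_two_le s hcard.2]
    -- Cuts with a singleton block vanish on both sides: by `s i i = 0` in the model, and by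
    -- definition of the coefficient.
    · have hz : pairPoly s T.1 * pairPoly s S.1 = 0 := by
        rw [not_and_or, not_le, not_le] at hcard
        rcases hcard with h | h
        · rw [pairPoly_eq_zero_of_card_le_one s h₀ (by omega), zero_mul]
        · rw [pairPoly_eq_zero_of_card_le_one s h₀ (B := S.1) (by omega), mul_zero]
      have hz' : resolutionCoeff A.1 B.1 {T, S} = 0 := by
        refine if_pos ?_
        rw [not_and_or, not_le, not_le] at hcard
        rcases hcard with h | h
        · exact ⟨T, by simp, h⟩
        · exact ⟨S, by simp, h⟩
      rw [hz, hz', zero_smul, smul_zero]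
  · intro i hi
    have := sum_sub_prevIn_le hU (colour A.1) hi
    change colour A.1 i = _ + ∑ r ∈ A.1 ∪ B.1 with r ≤ i, (colour A.1 r - colour A.1 (prevIn _ r))
    rw [this]
    ring

end Model

/-! ### Resolving a crossing lowers the crossing number. -/

section CrossingNumber

variable {n : ℕ}

/-- A set which crosses a part of `A ∪ B` crosses `A` or `B`, if `A` and `B` cross. -/
theorem Crosses.left_or_right {A B C S : Finset (Fin n)} (hAB : Crosses A B) (hS : S ⊆ A ∪ B)
    (h : Crosses C S) : Crosses C A ∨ Crosses C B := by
  by_contra hcon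
  rw [not_or] at hcon
  -- Two points of `C` separate `x` from `y` in `S`. If both lie in `A`, or both in `B`, that set
  -- crosses `C`.
  obtain ⟨c, c', x, y, hc, hc', hx, hy, hin, hout⟩ : ∃ c c' x y,
      c ∈ C ∧ c' ∈ C ∧ x ∈ S ∧ y ∈ S ∧ (c < x ∧ x < c') ∧ (y < c ∨ c' < y) := by
    obtain ⟨a, b, c, d, hab, hbc, hcd, h | h⟩ := h
    · exact ⟨a, c, b, d, h.1, h.2.1, h.2.2.1, h.2.2.2, ⟨hab, hbc⟩, Or.inr hcd⟩
    · exact ⟨b, d, c, a, h.2.2.1, h.2.2.2, h.2.1, h.1, ⟨hbc, hcd⟩, Or.inl hab⟩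
  have sep : ∀ D, ¬ Crosses C D → ∀ u ∈ D, ∀ v ∈ D, (c < u ∧ u < c') → (v < c ∨ c' < v) →
      False := by
    rintro D hD u hu v hv ⟨h1, h2⟩ (h3 | h3)
    · exact hD ⟨v, c, u, c', h3, h1, h2, Or.inr ⟨hv, hu, hc, hc'⟩⟩
    · exact hD ⟨c, u, c', v, h1, h2, h3, Or.inl ⟨hc, hc', hu, hv⟩⟩
  -- If `C` crosses neither set, each stays on its own side of `c`, `c'`; but some point of `B` lies
  -- between two points of `A`.
  have main : ∀ A B, Crosses A B → x ∈ A → y ∈ B → ¬ Crosses C A → ¬ Crosses C B → False := by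
    intro A B hAB hx hy hA hB
    obtain ⟨a, b, d, e, hab, hbd, hde, h | h⟩ := hAB
    · have h2 := sep A hA x hx a h.1 hin
      have h3 := sep A hA x hx d h.2.1 hin
      have h4 := sep B hB b h.2.2.1 y hy
      by_cases hb : c < b ∧ b < c'
      · exact h4 hb hout
      · have e1 : ¬ (a < c ∨ c' < a) := h2
        have e2 : ¬ (d < c ∨ c' < d) := h3
        rw [not_or, not_lt, not_lt] at e1 e2
        exact hb ⟨e1.1.trans_lt hab, hbd.trans_le e2.2⟩
    · have h2 := sep A hA x hx b h.2.2.1 hin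
      have h3 := sep A hA x hx e h.2.2.2 hin
      have e1 : ¬ (b < c ∨ c' < b) := h2
      have e2 : ¬ (e < c ∨ c' < e) := h3
      rw [not_or, not_lt, not_lt] at e1 e2
      exact sep B hB d h.2.1 y hy ⟨e1.1.trans_lt hbd, hde.trans_le e2.2⟩ hout
  rcases Finset.mem_union.1 (hS hx) with h1 | h1 <;> rcases Finset.mem_union.1 (hS hy) with h2 | h2
  · exact sep A hcon.1 x h1 y h2 hin hout
  · exact main A B hAB h1 h2 hcon.1 hcon.2
  · exact main B A hAB.symm h1 h2 hcon.2 hcon.1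
  · exact sep B hcon.2 x h1 y h2 hin hout

/-- A set which crosses both parts of a cut crosses every set with elements at the two ends of the
cut. -/
theorem crosses_of_crosses_cut {U C D : Finset (Fin n)} (hCU : Disjoint C U)
    {p q : Fin n} (hp : p ∈ U) (hpq : p < q)
    (hDp : p ∈ D ∨ prevIn U p ∈ D) (hDq : q ∈ D ∨ prevIn U q ∈ D)
    (hT : Crosses C (U.filter fun i => p ≤ i ∧ i < q))
    (hS : Crosses C (U.filter fun i => ¬ (p ≤ i ∧ i < q))) : Crosses C D := by
  have hne : ∀ c ∈ C, ∀ u ∈ U, c ≠ u := fun c hc u hu e => Finset.disjoint_left.1 hCU hc (e ▸ hu)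
  obtain ⟨hp'U, hp'⟩ := prevIn_spec ⟨p, hp⟩ p
  obtain ⟨hq'U, hq'⟩ := prevIn_spec ⟨p, hp⟩ q
  have hq'' : p ≤ prevIn U q ∧ prevIn U q < q ∧ ∀ y ∈ U, y < q → y ≤ prevIn U q := by
    rcases hq' with h | h
    · exact ⟨h.2 p hp hpq, h⟩
    · exact absurd (h.1 p hp) (not_le.2 hpq)
  set p' := prevIn U p
  set q' := prevIn U q
  -- `c` lies inside the arc from `p` to `q'`, and `e` below inside the cyclic arc from `q` to `p'`;
  -- the disjunction records where that arc passes the end of the order. So `c` and `e` separate any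
  -- element of `D` at `p'` or `p` from one at `q'` or `q`.
  obtain ⟨c, hc, hpc, hcq⟩ : ∃ c ∈ C, p < c ∧ c < q' := by
    obtain ⟨a, b, c, d, hab, hbc, hcd, h | h⟩ := hT
    · simp only [Finset.mem_filter] at h
      exact ⟨c, h.2.1, h.2.2.1.2.1.trans_lt hbc,
        hcd.trans_le (hq''.2.2 d h.2.2.2.1 h.2.2.2.2.2)⟩
    · simp only [Finset.mem_filter] at h
      exact ⟨b, h.2.2.1, h.1.2.1.trans_lt hab,
        hbc.trans_le (hq''.2.2 c h.2.1.1 h.2.1.2.2)⟩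
  obtain ⟨e, he, hout⟩ : ∃ e ∈ C, (q < e ∧ (p' < p ∨ e < p')) ∨ (e < p ∧ p' < p ∧ e < p') := by
    have hp'max : ∀ y ∈ U, y < p → p' < p ∧ y ≤ p' := by
      intro y hy hyp
      rcases hp' with h | h
      · exact ⟨h.1, h.2 y hy hyp⟩
      · exact absurd (h.1 y hy) (not_le.2 hyp)
    have hp'max' : ∀ y ∈ U, p' < p ∨ y ≤ p' := by
      intro y hy
      rcases hp' with h | h
      · exact Or.inl h.1
      · exact Or.inr (h.2 y hy)
    obtain ⟨x, y, c, d, hx, hy, hc, hd, hxy, hin, hd'⟩ : ∃ x y c d,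
        x ∈ U.filter (fun i => ¬ (p ≤ i ∧ i < q)) ∧ y ∈ U.filter (fun i => ¬ (p ≤ i ∧ i < q)) ∧
        c ∈ C ∧ d ∈ C ∧ x < y ∧ (x < c ∧ c < y) ∧ (d < x ∨ y < d) := by
      obtain ⟨a, b, c, d, hab, hbc, hcd, h | h⟩ := hS
      · exact ⟨b, d, c, a, h.2.2.1, h.2.2.2, h.2.1, h.1, hbc.trans hcd, ⟨hbc, hcd⟩, Or.inl hab⟩
      · exact ⟨a, c, b, d, h.1, h.2.1, h.2.2.1, h.2.2.2, hab.trans hbc, ⟨hab, hbc⟩, Or.inr hcd⟩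
    rw [Finset.mem_filter] at hx hy
    by_cases hyp : y < p
    · obtain ⟨h1, h2⟩ := hp'max y hy.1 hyp
      exact ⟨c, hc, Or.inr ⟨hin.2.trans hyp, h1, hin.2.trans_le h2⟩⟩
    · have hyq : q ≤ y := by
        by_contra h
        exact hy.2 ⟨not_lt.1 hyp, not_le.1 h⟩
      by_cases hxp : x < p
      · obtain ⟨h1, h2⟩ := hp'max x hx.1 hxp
        rcases hd' with h | h
        · exact ⟨d, hd, Or.inr ⟨h.trans hxp, h1, h.trans_le h2⟩⟩
        · exact ⟨d, hd, Or.inl ⟨hyq.trans_lt h, Or.inl h1⟩⟩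
      · have hxq : q ≤ x := by
          by_contra h
          exact hx.2 ⟨not_lt.1 hxp, not_le.1 h⟩
        refine ⟨c, hc, Or.inl ⟨hxq.trans_lt hin.1, (hp'max' y hy.1).imp_right fun h =>
          hin.2.trans_le h⟩⟩
  have hbp : ∃ b ∈ D, b = p ∨ b = p' := by
    rcases hDp with h | h
    · exact ⟨_, h, Or.inl rfl⟩
    · exact ⟨_, h, Or.inr rfl⟩
  have hbq : ∃ b ∈ D, b = q ∨ b = q' := by
    rcases hDq with h | h
    · exact ⟨_, h, Or.inl rfl⟩
    · exact ⟨_, h, Or.inr rfl⟩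
  obtain ⟨u, hu, hu'⟩ := hbp
  obtain ⟨v, hv, hv'⟩ := hbq
  have hcv : c < v := by
    rcases hv' with rfl | rfl
    · exact hcq.trans hq''.2.1
    · exact hcq
  rcases hout with ⟨h1, h2⟩ | ⟨h1, h2, h3⟩
  · have hve : v < e := by
      rcases hv' with rfl | rfl
      · exact h1
      · exact hq''.2.1.trans h1
    by_cases huc : u < c
    · exact ⟨u, c, v, e, huc, hcv, hve, Or.inr ⟨hu, hv, hc, he⟩⟩
    · have heu : e < u := by
        rcases hu' with rfl | rfl
        · exact absurd hpc huc
        · rcases h2 with h2 | h2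
          · exact absurd (h2.trans hpc) huc
          · exact h2
      exact ⟨c, v, e, u, hcv, hve, heu, Or.inl ⟨hc, he, hv, hu⟩⟩
  · have heu : e < u := by
      rcases hu' with rfl | rfl
      · exact h1
      · exact h3
    have huc : u < c := by
      rcases hu' with rfl | rfl
      · exact hpc
      · exact h2.trans hpc
    exact ⟨e, u, c, v, heu, huc, hcv, Or.inl ⟨he, hc, hu, hv⟩⟩

/-- The count for a third block: `t`, `s` are its crossings with the new blocks, `a`, `b` those with
the old ones. -/
theorem indicator_add_le_indicator_add {a b t s : Prop} [Decidable a] [Decidable b] [Decidable t]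
    [Decidable s] (ht : t → a ∨ b) (hs : s → a ∨ b) (hts : t → s → a ∧ b) :
    ((if t then 1 else 0) + (if s then 1 else 0) : ℕ) ≤
      (if a then 1 else 0) + (if b then 1 else 0) := by
  by_cases a <;> by_cases b <;> by_cases t <;> by_cases s <;> simp_all

theorem mem_or_prevIn_mem_of_jump_ne_zero {A B : Finset (Fin n)} (hAB : Disjoint A B) {p : Fin n}
    (hp : p ∈ A ∪ B) (h : jump (A ∪ B) A p ≠ 0) :
    (p ∈ A ∨ prevIn (A ∪ B) p ∈ A) ∧ (p ∈ B ∨ prevIn (A ∪ B) p ∈ B) := by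
  have h' : jump (A ∪ B) B p ≠ 0 := fun e => h ((jump_eq_zero_right hAB hp).1 e)
  rw [jump_ne_zero_iff] at h h'
  exact ⟨by tauto, by tauto⟩

theorem jump_ne_zero_of_resolutionCoeff_ne_zero {A B : Finset (Fin n)} (hAB : Disjoint A B)
    (hA : A.Nonempty) (hB : B.Nonempty) {p q : Fin n} (hp : p ∈ A ∪ B) (hq : q ∈ A ∪ B)
    (hpq : p < q) {T S : Block n}
    (hT : T.1 = (A ∪ B).filter fun i => p ≤ i ∧ i < q)
    (hS : S.1 = (A ∪ B).filter fun i => ¬ (p ≤ i ∧ i < q))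
    (h : resolutionCoeff A B {T, S} ≠ 0) :
    jump (A ∪ B) A p ≠ 0 ∧ jump (A ∪ B) A q ≠ 0 := by
  have hcard : 2 ≤ T.1.card ∧ 2 ≤ S.1.card := by
    by_contra hcon
    refine h (if_pos ?_)
    rw [not_and_or, not_le, not_le] at hcon
    rcases hcon with h | h
    · exact ⟨T, by simp, h⟩
    · exact ⟨S, by simp, h⟩
  rw [resolutionCoeff_cut hAB hA hB hp hq hpq hT hS hcard.1 hcard.2, neg_ne_zero] at h
  exact ⟨left_ne_zero_of_mul h, right_ne_zero_of_mul h⟩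

open Classical in
/-- The indicator of crossing of two different blocks. -/
noncomputable def crossingIndicator (X Y : Block n) : ℕ :=
  if X ≠ Y ∧ Crosses X.1 Y.1 then 1 else 0

/-- The number of ordered pairs of members of the family which cross. -/
noncomputable def crossingNumber (P : Finset (Block n)) : ℕ :=
  ∑ X ∈ P, ∑ Y ∈ P, crossingIndicator X Y

theorem crossingIndicator_comm (X Y : Block n) : crossingIndicator X Y = crossingIndicator Y X := by
  classical
  exact if_congr (and_congr ne_comm crosses_comm) rfl rfl

open Classical in
theorem crossingIndicator_of_ne {X Y : Block n} (h : X ≠ Y) :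
    crossingIndicator X Y = if Crosses X.1 Y.1 then 1 else 0 :=
  if_congr (and_iff_right h) rfl rfl

theorem crossingIndicator_self (X : Block n) : crossingIndicator X X = 0 := if_neg (by simp)

theorem crossingNumber_insert_insert {X Y : Block n} {P : Finset (Block n)} (hXY : X ≠ Y)
    (hX : X ∉ P) (hY : Y ∉ P) : crossingNumber (insert X (insert Y P)) =
      2 * crossingIndicator X Y +
        2 * ∑ Z ∈ P, (crossingIndicator Z X + crossingIndicator Z Y) + crossingNumber P := by
  unfold crossingNumber
  have hX' : X ∉ insert Y P := by simp [hXY, hX]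
  have eX : ∑ Z ∈ P, crossingIndicator X Z = ∑ Z ∈ P, crossingIndicator Z X :=
    Finset.sum_congr rfl fun Z _ => crossingIndicator_comm X Z
  have eY : ∑ Z ∈ P, crossingIndicator Y Z = ∑ Z ∈ P, crossingIndicator Z Y :=
    Finset.sum_congr rfl fun Z _ => crossingIndicator_comm Y Z
  simp only [Finset.sum_insert hX', Finset.sum_insert hY, Finset.sum_add_distrib,
    crossingIndicator_self, crossingIndicator_comm Y X, eX, eY]
  ring

/-- Resolving a crossing reduces the number of crossings. -/
theorem crossingNumber_resolve_lt {A B T S : Block n} {P : Finset (Block n)}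
    (hAB : Disjoint A.1 B.1) (hc : Crosses A.1 B.1)
    (hP : ∀ C ∈ P, Disjoint C.1 (A.1 ∪ B.1)) {p q : Fin n}
    (hp : p ∈ A.1 ∪ B.1) (hq : q ∈ A.1 ∪ B.1) (hpq : p < q)
    (hT : T.1 = (A.1 ∪ B.1).filter fun i => p ≤ i ∧ i < q)
    (hS : S.1 = (A.1 ∪ B.1).filter fun i => ¬ (p ≤ i ∧ i < q))
    (h : resolutionCoeff A.1 B.1 {T, S} ≠ 0) :
    crossingNumber (insert T (insert S P)) < crossingNumber (insert A (insert B P)) := by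
  have hnot : ∀ X : Block n, X.1 ⊆ A.1 ∪ B.1 → X ∉ P := by
    intro X hX hXP
    obtain ⟨x, hx⟩ := X.2
    exact Finset.disjoint_left.1 (hP X hXP) hx (hX hx)
  have hTU : T.1 ⊆ A.1 ∪ B.1 := hT ▸ Finset.filter_subset _ _
  have hSU : S.1 ⊆ A.1 ∪ B.1 := hS ▸ Finset.filter_subset _ _
  have hABne : A ≠ B := by
    rintro rfl
    obtain ⟨x, hx⟩ := A.2
    exact Finset.disjoint_left.1 hAB hx hx
  have hTS := cut_ne hp hpq hT hS
  rw [crossingNumber_insert_insert hTS (hnot T hTU) (hnot S hSU),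
    crossingNumber_insert_insert hABne (hnot A Finset.subset_union_left)
      (hnot B Finset.subset_union_right)]
  have h1 : crossingIndicator A B = 1 := if_pos ⟨hABne, hc⟩
  have h2 : crossingIndicator T S = 0 := by
    have := (mem_twoBlockNoncrossing.1 (cut_mem_twoBlockNoncrossing hp hpq hT hS)).2.1
    exact if_neg fun h => (this T (by simp) S (by simp) hTS).2 h.2
  have h3 : ∑ Z ∈ P, (crossingIndicator Z T + crossingIndicator Z S) ≤
      ∑ Z ∈ P, (crossingIndicator Z A + crossingIndicator Z B) := by
    refine Finset.sum_le_sum fun Z hZ => ?_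
    have hne : ∀ X : Block n, X.1 ⊆ A.1 ∪ B.1 → Z ≠ X := fun X hX e => hnot X hX (e ▸ hZ)
    have hT1 := hne T hTU
    have hS1 := hne S hSU
    have hA1 := hne A Finset.subset_union_left
    have hB1 := hne B Finset.subset_union_right
    obtain ⟨hjp, hjq⟩ := jump_ne_zero_of_resolutionCoeff_ne_zero hAB A.2 B.2 hp hq hpq hT hS h
    have hp2 := mem_or_prevIn_mem_of_jump_ne_zero hAB hp hjp
    have hq2 := mem_or_prevIn_mem_of_jump_ne_zero hAB hq hjq
    have tT : Crosses Z.1 T.1 → Crosses Z.1 A.1 ∨ Crosses Z.1 B.1 := hc.left_or_right hTU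
    have tS : Crosses Z.1 S.1 → Crosses Z.1 A.1 ∨ Crosses Z.1 B.1 := hc.left_or_right hSU
    have both : Crosses Z.1 T.1 → Crosses Z.1 S.1 → Crosses Z.1 A.1 ∧ Crosses Z.1 B.1 := by
      rw [hT, hS]
      intro h1 h2
      exact ⟨crosses_of_crosses_cut (hP Z hZ) hp hpq hp2.1 hq2.1 h1 h2,
        crosses_of_crosses_cut (hP Z hZ) hp hpq hp2.2 hq2.2 h1 h2⟩
    rw [crossingIndicator_of_ne hT1, crossingIndicator_of_ne hS1, crossingIndicator_of_ne hA1,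
      crossingIndicator_of_ne hB1]
    classical
    exact indicator_add_le_indicator_add tT tS both
  omega

end CrossingNumber

/-! ### Noncrossing monomials span the quotient. -/

section Spanning

variable {n : ℕ}

theorem blockMonomial_insert {X : Block n} {P : Finset (Block n)} (h : X ∉ P) :
    blockMonomial (insert X P) = MvPolynomial.X X * blockMonomial P := by
  classical
  unfold blockMonomial
  convert Finset.prod_insert h

/-- The span of the noncrossing monomials in the quotient ring. -/
noncomputable def noncrossingSpan (n : ℕ) :
    Submodule ℂ (MvPolynomial (Block n) ℂ ⧸ (crossingIdeal n ⊔ overlapIdeal n)) :=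
  Submodule.span ℂ (Set.range fun P : {P : Finset (Block n) // IsNoncrossingFamily P} =>
    Ideal.Quotient.mk (crossingIdeal n ⊔ overlapIdeal n) (blockMonomial P.1))

/-- Induction on the crossing number. Resolving a crossing pair keeps the blocks disjoint, because
the new pair has the same union as the old one. -/
theorem mk_blockMonomial_mem_noncrossingSpan (P : Finset (Block n))
    (hP : ∀ X ∈ P, ∀ Y ∈ P, X ≠ Y → Disjoint X.1 Y.1) :
    Ideal.Quotient.mk (crossingIdeal n ⊔ overlapIdeal n) (blockMonomial P) ∈ noncrossingSpan n := by
  induction hN : crossingNumber P using Nat.strong_induction_on generalizing P with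
  | _ N ih =>
  by_cases hnc : IsNoncrossingFamily P
  · exact Submodule.subset_span ⟨⟨P, hnc⟩, rfl⟩
  obtain ⟨A, hA, B, hB, hAB, hc⟩ : ∃ A ∈ P, ∃ B ∈ P, A ≠ B ∧ Crosses A.1 B.1 := by
    by_contra hcon
    push Not at hcon
    exact hnc fun X hX Y hY hXY => ⟨hP X hX Y hY hXY, hcon X hX Y hY hXY⟩
  have hdAB := hP A hA B hB hAB
  obtain ⟨Q, hAQ, hBQ, rfl⟩ : ∃ Q, A ∉ Q ∧ B ∉ Q ∧ P = insert A (insert B Q) := by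
    refine ⟨(P.erase A).erase B, by simp, by simp, ?_⟩
    rw [Finset.insert_erase (Finset.mem_erase.2 ⟨hAB.symm, hB⟩), Finset.insert_erase hA]
  have hABQ : A ∉ insert B Q := by simp [hAB, hAQ]
  have hQ : ∀ C ∈ Q, Disjoint C.1 (A.1 ∪ B.1) := fun C hC => by
    rw [Finset.disjoint_union_right]
    exact ⟨hP C (by simp [hC]) A (by simp) (by rintro rfl; exact hAQ hC),
      hP C (by simp [hC]) B (by simp) (by rintro rfl; exact hBQ hC)⟩
  have hrel : Ideal.Quotient.mk (crossingIdeal n ⊔ overlapIdeal n)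
      (blockMonomial (insert A (insert B Q))) =
      ∑ P ∈ twoBlockNoncrossing (A.1 ∪ B.1), resolutionCoeff A.1 B.1 P •
        Ideal.Quotient.mk (crossingIdeal n ⊔ overlapIdeal n) (blockMonomial P * blockMonomial Q) := by
    simp only [← map_zsmul]
    rw [← map_sum, Ideal.Quotient.eq, blockMonomial_insert hABQ, blockMonomial_insert hBQ]
    have hmem : crossingRelation A B ∈ crossingIdeal n :=
      Ideal.subset_span ⟨A, B, hdAB, hc, rfl⟩
    have := Ideal.mul_mem_right (blockMonomial Q) _
      ((le_sup_left : crossingIdeal n ≤ crossingIdeal n ⊔ overlapIdeal n) hmem)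
    convert this using 1
    rw [crossingRelation, sub_mul, Finset.sum_mul, mul_assoc]
    simp only [smul_mul_assoc]
  rw [hrel]
  refine Submodule.sum_mem _ fun R hR => ?_
  by_cases h0 : resolutionCoeff A.1 B.1 R = 0
  · rw [h0, zero_smul]
    exact Submodule.zero_mem _
  obtain ⟨p, hp, q, hq, hpq, T, S, hT, hS, rfl⟩ := exists_cut hR
  refine zsmul_mem ?_ _
  have hnot : ∀ X : Block n, X.1 ⊆ A.1 ∪ B.1 → X ∉ Q := by
    intro X hX hXQ
    obtain ⟨x, hx⟩ := X.2
    exact Finset.disjoint_left.1 (hQ X hXQ) hx (hX hx)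
  have hTU : T.1 ⊆ A.1 ∪ B.1 := hT ▸ Finset.filter_subset _ _
  have hSU : S.1 ⊆ A.1 ∪ B.1 := hS ▸ Finset.filter_subset _ _
  have hTS := cut_ne hp hpq hT hS
  have hdTS : Disjoint T.1 S.1 := by
    rw [hT, hS]
    exact Finset.disjoint_filter_filter_not _ _ _
  have hTSQ : T ∉ insert S Q := by simp [hTS, hnot T hTU]
  have hmon : blockMonomial {T, S} * blockMonomial Q = blockMonomial (insert T (insert S Q)) := by
    rw [blockMonomial_insert hTSQ, blockMonomial_insert (hnot S hSU),
      blockMonomial_insert (by simpa using hTS)]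
    simp [blockMonomial, mul_assoc]
  rw [hmon]
  refine ih _ ?_ _ ?_ rfl
  · rw [← hN]
    exact crossingNumber_resolve_lt hdAB hc hQ hp hq hpq hT hS h0
  · have hQQ : ∀ X ∈ Q, ∀ Y ∈ Q, X ≠ Y → Disjoint X.1 Y.1 := fun X hX Y hY h =>
      hP X (by simp [hX]) Y (by simp [hY]) h
    intro X hX Y hY hXY
    simp only [Finset.mem_insert] at hX hY
    rcases hX with rfl | rfl | hX <;> rcases hY with rfl | rfl | hY
    · exact absurd rfl hXY
    · exact hdTS
    · exact ((hQ Y hY).mono_right hTU).symm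
    · exact hdTS.symm
    · exact absurd rfl hXY
    · exact ((hQ Y hY).mono_right hSU).symm
    · exact (hQ X hX).mono_right hTU
    · exact (hQ X hX).mono_right hSU
    · exact hQQ X hX Y hY hXY

theorem mk_X_mul_blockMonomial_mem_noncrossingSpan (B : Block n) (P : Finset (Block n))
    (hP : ∀ X ∈ P, ∀ Y ∈ P, X ≠ Y → Disjoint X.1 Y.1) :
    Ideal.Quotient.mk (crossingIdeal n ⊔ overlapIdeal n) (MvPolynomial.X B * blockMonomial P) ∈
      noncrossingSpan n := by
  by_cases h : ∃ A ∈ P, (B.1 ∩ A.1).Nonempty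
  · obtain ⟨A, hA, hBA⟩ := h
    have hmon : blockMonomial P = MvPolynomial.X A * blockMonomial (P.erase A) := by
      rw [← blockMonomial_insert (by simp), Finset.insert_erase hA]
    have hmem : MvPolynomial.X B * MvPolynomial.X A ∈ overlapIdeal n :=
      Ideal.subset_span ⟨B, A, hBA, rfl⟩
    have := Ideal.mul_mem_right (blockMonomial (P.erase A)) _
      ((le_sup_right : overlapIdeal n ≤ crossingIdeal n ⊔ overlapIdeal n) hmem)
    rw [hmon, ← mul_assoc, Ideal.Quotient.eq_zero_iff_mem.2 this]
    exact Submodule.zero_mem _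
  · push Not at h
    have hd : ∀ A ∈ P, Disjoint B.1 A.1 := fun A hA => Finset.disjoint_iff_inter_eq_empty.2 (h A hA)
    have hB : B ∉ P := fun hB => by
      obtain ⟨x, hx⟩ := B.2
      exact Finset.disjoint_left.1 (hd B hB) hx hx
    rw [← blockMonomial_insert hB]
    apply mk_blockMonomial_mem_noncrossingSpan
    intro X hX Y hY hXY
    rw [Finset.mem_insert] at hX hY
    rcases hX with rfl | hX <;> rcases hY with rfl | hY
    · exact absurd rfl hXY
    · exact hd Y hY
    · exact (hd X hX).symm
    · exact hP X hX Y hY hXY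

/-- The span contains 1, the monomial of the empty family, and is stable under multiplication by the
variables. -/
theorem noncrossingSpan_eq_top (n : ℕ) : noncrossingSpan n = ⊤ := by
  have hmul : ∀ B : Block n, ∀ x ∈ noncrossingSpan n,
      Ideal.Quotient.mk (crossingIdeal n ⊔ overlapIdeal n) (MvPolynomial.X B) * x ∈
        noncrossingSpan n := by
    intro B x hx
    induction hx using Submodule.span_induction with
    | mem x hx =>
      obtain ⟨P, rfl⟩ := hx
      have := mk_X_mul_blockMonomial_mem_noncrossingSpan B P.1 fun X hX Y hY h =>
        (P.2 X hX Y hY h).1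
      rwa [map_mul] at this
    | zero => rw [mul_zero]; exact Submodule.zero_mem _
    | add x y _ _ hx hy => rw [mul_add]; exact Submodule.add_mem _ hx hy
    | smul a x _ hx => rw [mul_smul_comm]; exact Submodule.smul_mem _ a hx
  rw [eq_top_iff]
  rintro x -
  obtain ⟨f, rfl⟩ := Ideal.Quotient.mk_surjective x
  induction f using MvPolynomial.induction_on with
  | C a =>
    have h1 := mk_blockMonomial_mem_noncrossingSpan (n := n) ∅ (by simp)
    have h2 := Submodule.smul_mem _ a h1
    have h3 : Ideal.Quotient.mk (crossingIdeal n ⊔ overlapIdeal n) (MvPolynomial.C a) =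
        a • Ideal.Quotient.mk (crossingIdeal n ⊔ overlapIdeal n) (blockMonomial ∅) := by
      have : (MvPolynomial.C a : MvPolynomial (Block n) ℂ) = a • blockMonomial ∅ := by
        simp [blockMonomial, MvPolynomial.smul_eq_C_mul]
      rw [this]
      rfl
    rw [h3]
    exact h2
  | add f g hf hg => rw [map_add]; exact Submodule.add_mem _ hf hg
  | mul_X f B hf => rw [map_mul, mul_comm]; exact hmul B _ hf

end Spanning

/-! ### Noncrossing families are determined by their words. -/

section Words

variable {n : ℕ}

/-- The letter of the element `k` of the block `B`: `3` for a singleton, `0` for the least element,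
`1` for the largest one and `2` for the others. -/
noncomputable def blockLetter (B : Block n) (k : Fin n) : Fin 4 :=
  if B.1.card = 1 then 3 else pairLabel (B.1.min' B.2) (B.1.max' B.2) k

/-- The exponent vector of the letters of a block. -/
noncomputable def blockWord (B : Block n) : Fin 4 × Fin n →₀ ℕ :=
  ∑ k ∈ B.1, Finsupp.single (blockLetter B k, k) 1

/-- The exponent vector of the letters of a family of blocks. -/
noncomputable def familyWord (P : Finset (Block n)) : Fin 4 × Fin n →₀ ℕ :=
  ∑ B ∈ P, blockWord B

theorem blockLetter_eq_three {B : Block n} {k : Fin n} :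
    blockLetter B k = 3 ↔ B.1.card = 1 := by
  unfold blockLetter pairLabel
  split_ifs <;> simp_all

theorem blockLetter_eq_zero {B : Block n} {k : Fin n} :
    blockLetter B k = 0 ↔ B.1.card ≠ 1 ∧ k = B.1.min' B.2 := by
  unfold blockLetter pairLabel
  split_ifs <;> simp_all

theorem Block.min'_lt_max' {B : Block n} (hB : B.1.card ≠ 1) : B.1.min' B.2 < B.1.max' B.2 := by
  have := B.2.card_pos
  exact Finset.min'_lt_max'_of_card _ (by omega)

theorem blockLetter_eq_one {B : Block n} {k : Fin n} :
    blockLetter B k = 1 ↔ B.1.card ≠ 1 ∧ k = B.1.max' B.2 := by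
  by_cases hB : B.1.card = 1
  · simp [blockLetter, hB]
  · have := Block.min'_lt_max' hB
    unfold blockLetter pairLabel
    rw [if_neg hB]
    constructor
    · intro h
      refine ⟨hB, ?_⟩
      split_ifs at h with h1 h2
      · simp at h
      · exact h2
      · simp at h
    · rintro ⟨-, rfl⟩
      rw [if_neg this.ne', if_pos rfl]

theorem familyWord_ne_zero_iff {P : Finset (Block n)} {a : Fin 4} {k : Fin n} :
    familyWord P (a, k) ≠ 0 ↔ ∃ B ∈ P, k ∈ B.1 ∧ blockLetter B k = a := by
  have hB (B : Block n) : blockWord B (a, k) ≠ 0 ↔ k ∈ B.1 ∧ blockLetter B k = a := by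
    rw [blockWord, Finsupp.finsetSum_apply, ne_eq, Finset.sum_eq_zero_iff]
    push Not
    constructor
    · rintro ⟨m, hm, h⟩
      rw [Finsupp.single_apply, ne_eq, ite_eq_right_iff, Classical.not_imp] at h
      obtain ⟨h1, h2⟩ := Prod.mk.inj h.1
      subst h2
      exact ⟨hm, h1⟩
    · rintro ⟨hk, rfl⟩
      exact ⟨k, hk, by simp⟩
  rw [familyWord, Finsupp.finsetSum_apply, ne_eq, Finset.sum_eq_zero_iff]
  push Not
  simp only [hB]

theorem familyWord_multiplicity_le_one {P : Finset (Block n)} (hP : IsNoncrossingFamily P)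
    (k : Fin n) : ∑ a, familyWord P (a, k) ≤ 1 := by
  classical
  have hB (B : Block n) : ∑ a, blockWord B (a, k) = if k ∈ B.1 then 1 else 0 := by
    simp only [blockWord, Finsupp.finsetSum_apply, Finsupp.single_apply, Prod.mk.injEq]
    rw [Finset.sum_comm]
    simp only [ite_and, Finset.sum_ite_eq, Finset.mem_univ, if_true, Finset.sum_ite_eq']
  simp only [familyWord, Finsupp.finsetSum_apply]
  rw [Finset.sum_comm]
  simp only [hB]
  rw [← Finset.card_filter, Finset.card_le_one]
  intro X hX Y hY
  rw [Finset.mem_filter] at hX hY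
  by_contra hne
  exact Finset.disjoint_left.1 (hP X hX.1 Y hY.1 hne).1 hX.2 hY.2

theorem IsNoncrossingFamily.eq_of_mem {P : Finset (Block n)} (hP : IsNoncrossingFamily P)
    {X Y : Block n} (hX : X ∈ P) (hY : Y ∈ P) {k : Fin n} (hkX : k ∈ X.1) (hkY : k ∈ Y.1) :
    X = Y := by
  by_contra hne
  exact Finset.disjoint_left.1 (hP X hX Y hY hne).1 hkX hkY

/-- Two blocks which begin at the same element agree, if the blocks which begin later agree. -/
theorem subset_of_later_blocks {P Q : Finset (Block n)} (hP : IsNoncrossingFamily P)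
    (hQ : IsNoncrossingFamily Q)
    (hw : ∀ a k, (∃ B ∈ P, k ∈ B.1 ∧ blockLetter B k = a) ↔
      ∃ B ∈ Q, k ∈ B.1 ∧ blockLetter B k = a) {o : Fin n}
    (hPQ : ∀ B ∈ P, B.1.card ≠ 1 → o < B.1.min' B.2 → B ∈ Q)
    (hQP : ∀ B ∈ Q, B.1.card ≠ 1 → o < B.1.min' B.2 → B ∈ P)
    {B C : Block n} (hB : B ∈ P) (hC : C ∈ Q) (hB1 : B.1.card ≠ 1) (hC1 : C.1.card ≠ 1)
    (hBo : B.1.min' B.2 = o) (hCo : C.1.min' C.2 = o) : B.1 ⊆ C.1 := by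
  intro u huB
  by_contra huC
  have hoB : o ∈ B.1 := hBo ▸ B.1.min'_mem B.2
  have hoC : o ∈ C.1 := hCo ▸ C.1.min'_mem C.2
  have hou : o < u := lt_of_le_of_ne (hBo ▸ B.1.min'_le u huB) (fun e => huC (e ▸ hoC))
  have hCv := Block.min'_lt_max' hC1
  have hv := C.1.max'_mem C.2
  set v := C.1.max' C.2 with hvdef
  rw [hCo] at hCv
  -- The block `D'` of `u` in `Q` begins before `o`: if it began later it would belong to `P` and
  -- meet `B` in `u`. Since `D'` does not cross `C`, the element `u` comes after the end `v` of `C`.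
  obtain ⟨D', hD', huD', hlet⟩ := (hw (blockLetter B u) u).1 ⟨B, hB, huB, rfl⟩
  have hD'1 : D'.1.card ≠ 1 := fun h => by
    rw [← blockLetter_eq_three (k := u), hlet, blockLetter_eq_three] at h
    exact hB1 h
  have hD'C : D' ≠ C := fun e => huC (e ▸ huD')
  have ho' : D'.1.min' D'.2 < o := by
    rcases lt_trichotomy (D'.1.min' D'.2) o with h | h | h
    · exact h
    · exact absurd (hQ.eq_of_mem hD' hC (h ▸ D'.1.min'_mem D'.2) hoC) hD'C
    · have e := hP.eq_of_mem (hQP D' hD' hD'1 h) hB huD' huB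
      subst e
      exact absurd hBo h.ne'
  have hvu : v < u := by
    by_contra h
    have huv : u < v := lt_of_le_of_ne (not_lt.1 h) (fun e => huC (e ▸ hv))
    exact (hQ D' hD' C hC hD'C).2 ⟨_, o, u, v, ho', hou, huv,
      Or.inl ⟨D'.1.min'_mem D'.2, huD', hoC, hv⟩⟩
  -- In `P`, the block closed at `v` likewise begins before `o`, and so crosses `B` along `o < v <
  -- u`.
  obtain ⟨D, hD, hvD, hDlet⟩ := (hw 1 v).2 ⟨C, hC, hv, blockLetter_eq_one.2 ⟨hC1, rfl⟩⟩
  obtain ⟨hD1, hvmax⟩ := blockLetter_eq_one.1 hDlet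
  have hDB : D ≠ B := fun e => by
    subst e
    exact absurd (D.1.le_max' u huB) (not_le.2 (hvmax ▸ hvu))
  have ho : D.1.min' D.2 < o := by
    rcases lt_trichotomy (D.1.min' D.2) o with h | h | h
    · exact h
    · exact absurd (hP.eq_of_mem hD hB (h ▸ D.1.min'_mem D.2) hoB) hDB
    · have e := hQ.eq_of_mem (hPQ D hD hD1 h) hC hvD hv
      subst e
      exact absurd hCo h.ne'
  exact (hP D hD B hB hDB).2 ⟨_, o, v, u, ho, hCv, hvu,
    Or.inl ⟨D.1.min'_mem D.2, hvD, hoB, huB⟩⟩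

/-- Downward induction on the opener, so that all blocks beginning later are already matched. -/
theorem mem_iff_mem_of_familyWord_eq {P Q : Finset (Block n)} (hP : IsNoncrossingFamily P)
    (hQ : IsNoncrossingFamily Q)
    (hw : ∀ a k, (∃ B ∈ P, k ∈ B.1 ∧ blockLetter B k = a) ↔
      ∃ B ∈ Q, k ∈ B.1 ∧ blockLetter B k = a) (o : Fin n) :
    (∀ B ∈ P, B.1.card ≠ 1 → B.1.min' B.2 = o → B ∈ Q) ∧
      (∀ B ∈ Q, B.1.card ≠ 1 → B.1.min' B.2 = o → B ∈ P) := by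
  induction o using WellFoundedGT.induction with
  | ind o ih =>
    have hPQ : ∀ B ∈ P, B.1.card ≠ 1 → o < B.1.min' B.2 → B ∈ Q :=
      fun B hB h1 h => (ih _ h).1 B hB h1 rfl
    have hQP : ∀ B ∈ Q, B.1.card ≠ 1 → o < B.1.min' B.2 → B ∈ P :=
      fun B hB h1 h => (ih _ h).2 B hB h1 rfl
    have hw' := fun a k => (hw a k).symm
    constructor
    · rintro B hB hB1 rfl
      obtain ⟨C, hC, hoC, hlet⟩ := (hw 0 (B.1.min' B.2)).1
        ⟨B, hB, B.1.min'_mem B.2, blockLetter_eq_zero.2 ⟨hB1, rfl⟩⟩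
      obtain ⟨hC1, hCo⟩ := blockLetter_eq_zero.1 hlet
      have e : B = C := Subtype.ext ((subset_of_later_blocks hP hQ hw hPQ hQP hB hC hB1 hC1 rfl
        hCo.symm).antisymm (subset_of_later_blocks hQ hP hw' hQP hPQ hC hB hC1 hB1 hCo.symm rfl))
      exact e ▸ hC
    · rintro B hB hB1 rfl
      obtain ⟨C, hC, hoC, hlet⟩ := (hw 0 (B.1.min' B.2)).2
        ⟨B, hB, B.1.min'_mem B.2, blockLetter_eq_zero.2 ⟨hB1, rfl⟩⟩
      obtain ⟨hC1, hCo⟩ := blockLetter_eq_zero.1 hlet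
      have e : B = C := Subtype.ext ((subset_of_later_blocks hQ hP hw' hQP hPQ hB hC hB1 hC1 rfl
        hCo.symm).antisymm (subset_of_later_blocks hP hQ hw hPQ hQP hC hB hC1 hB1 hCo.symm rfl))
      exact e ▸ hC

theorem subset_of_familyWord_eq {P Q : Finset (Block n)} (hP : IsNoncrossingFamily P)
    (hQ : IsNoncrossingFamily Q) (h : familyWord P = familyWord Q) : P ⊆ Q := by
  have hw : ∀ a k, (∃ B ∈ P, k ∈ B.1 ∧ blockLetter B k = a) ↔
      ∃ B ∈ Q, k ∈ B.1 ∧ blockLetter B k = a := fun a k => by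
    rw [← familyWord_ne_zero_iff, ← familyWord_ne_zero_iff, h]
  intro B hB
  by_cases hB1 : B.1.card = 1
  · obtain ⟨k, hk⟩ := Finset.card_eq_one.1 hB1
    obtain ⟨C, hC, hkC, hlet⟩ := (hw 3 k).1 ⟨B, hB, by simp [hk], blockLetter_eq_three.2 hB1⟩
    obtain ⟨m, hm⟩ := Finset.card_eq_one.1 (blockLetter_eq_three.1 hlet)
    rw [hm, Finset.mem_singleton] at hkC
    have e : B = C := Subtype.ext (by rw [hk, hm, hkC])
    exact e ▸ hC
  · exact (mem_iff_mem_of_familyWord_eq hP hQ hw _).1 B hB hB1 rfl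

/-- A noncrossing family is determined by the letters of its elements. -/
theorem familyWord_injOn {P Q : Finset (Block n)} (hP : IsNoncrossingFamily P)
    (hQ : IsNoncrossingFamily Q) (h : familyWord P = familyWord Q) : P = Q :=
  (subset_of_familyWord_eq hP hQ h).antisymm (subset_of_familyWord_eq hQ hP h.symm)

end Words

/-! ### Leading terms for an additive weight. -/

section LeadingTerms

/-- The monomial `m` occurs in `f` with coefficient `c` and all others have smaller weight. -/
def IsLeadingTerm {σ K : Type*} [CommSemiring K] (wt : (σ →₀ ℕ) →+ ℤ) (f : MvPolynomial σ K)
    (m : σ →₀ ℕ) (c : K) : Prop :=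
  f.coeff m = c ∧ ∀ u, u ≠ m → f.coeff u ≠ 0 → wt u < wt m

variable {σ K : Type*} [CommSemiring K] {wt : (σ →₀ ℕ) →+ ℤ}

/-- Only one pair of exponents can reach the top weight, so zero divisors in `K` do no harm; the
leading coefficient may itself vanish. -/
theorem IsLeadingTerm.mul {f g : MvPolynomial σ K} {m m' : σ →₀ ℕ} {c c' : K}
    (hf : IsLeadingTerm wt f m c) (hg : IsLeadingTerm wt g m' c') :
    IsLeadingTerm wt (f * g) (m + m') (c * c') := by
  classical
  have le : ∀ {f : MvPolynomial σ K} {m c}, IsLeadingTerm wt f m c → ∀ u, f.coeff u ≠ 0 →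
      wt u ≤ wt m := by
    intro f m c h u hu
    by_cases e : u = m
    · rw [e]
    · exact (h.2 u e hu).le
  constructor
  · rw [MvPolynomial.coeff_mul, Finset.sum_eq_single (m, m'), hf.1, hg.1]
    · rintro ⟨u, u'⟩ hu hne
      rw [Finset.HasAntidiagonal.mem_antidiagonal] at hu
      by_contra h0
      have h1 := left_ne_zero_of_mul h0
      have h2 := right_ne_zero_of_mul h0
      have h3 := congrArg wt hu
      simp only [map_add] at h3
      have h4 := le hf u h1
      have h5 := le hg u' h2
      have e1 : u = m := by
        by_contra e
        have := hf.2 u e h1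
        omega
      have e2 : u' = m' := by
        by_contra e
        have := hg.2 u' e h2
        omega
      exact hne (by rw [e1, e2])
    · intro h
      rw [Finset.HasAntidiagonal.mem_antidiagonal] at h
      exact absurd rfl h
  · intro v hv h0
    rw [MvPolynomial.coeff_mul] at h0
    obtain ⟨⟨u, u'⟩, hu, h⟩ := Finset.exists_ne_zero_of_sum_ne_zero h0
    rw [Finset.HasAntidiagonal.mem_antidiagonal] at hu
    have h1 := left_ne_zero_of_mul h
    have h2 := right_ne_zero_of_mul h
    have h4 := le hf u h1
    have h5 := le hg u' h2
    have hv' : wt v = wt u + wt u' := hu ▸ map_add wt u u'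
    rw [hv', map_add]
    by_cases e : u = m
    · have e' : u' ≠ m' := fun e' => hv (by rw [← hu, e, e'])
      have := hg.2 u' e' h2
      omega
    · have := hf.2 u e h1
      omega

theorem IsLeadingTerm.prod {ι : Type*} (P : Finset ι) {f : ι → MvPolynomial σ K}
    {m : ι → σ →₀ ℕ} {c : ι → K} (h : ∀ i ∈ P, IsLeadingTerm wt (f i) (m i) (c i)) :
    IsLeadingTerm wt (∏ i ∈ P, f i) (∑ i ∈ P, m i) (∏ i ∈ P, c i) := by
  classical
  induction P using Finset.induction_on with
  | empty =>
    refine ⟨by simp, fun u hu h0 => ?_⟩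
    rw [Finset.prod_empty, MvPolynomial.coeff_one] at h0
    simp only [ne_eq, ite_eq_right_iff, Classical.not_imp] at h0
    exact absurd h0.1.symm hu
  | insert a P ha ih =>
    rw [Finset.prod_insert ha, Finset.sum_insert ha, Finset.prod_insert ha]
    exact (h a (Finset.mem_insert_self _ _)).mul
      (ih fun i hi => h i (Finset.mem_insert_of_mem hi))

theorem isLeadingTerm_sum {ι : Type*} (S : Finset ι) (m : ι → σ →₀ ℕ) (c : ι → K) {x : ι}
    (hx : x ∈ S) (h : ∀ y ∈ S, y ≠ x → c y ≠ 0 → wt (m y) < wt (m x)) :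
    IsLeadingTerm wt (∑ y ∈ S, MvPolynomial.monomial (m y) (c y)) (m x) (c x) := by
  classical
  constructor
  · rw [MvPolynomial.coeff_sum, Finset.sum_eq_single x]
    · simp
    · intro y hy hne
      rw [MvPolynomial.coeff_monomial]
      split_ifs with e
      · by_contra h0
        have := h y hy hne h0
        rw [e] at this
        exact lt_irrefl _ this
      · rfl
    · exact fun h => absurd hx h
  · intro u hu h0
    rw [MvPolynomial.coeff_sum] at h0
    obtain ⟨y, hy, hne⟩ := Finset.exists_ne_zero_of_sum_ne_zero h0
    rw [MvPolynomial.coeff_monomial, ne_eq, ite_eq_right_iff, Classical.not_imp] at hne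
    rw [← hne.1]
    exact h y hy (fun e => hu (by rw [← hne.1, e])) hne.2

end LeadingTerms

/-! ### Linear independence through leading words. -/

section ModelIndependence

variable {n : ℕ} {K : Type*} [CommRing K] (s : Fin n → Fin n → K)

/-- The weight of a word: the positions of the closers minus the positions of the openers. -/
noncomputable def wordWeight (n : ℕ) : (Fin 4 × Fin n →₀ ℕ) →+ ℤ :=
  Finsupp.weight fun v =>
    if v.1 = 0 then -((v.2 : ℕ) : ℤ) else if v.1 = 1 then ((v.2 : ℕ) : ℤ) else 0

/-- The leading coefficient of `blockPoly s B`. -/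
noncomputable def blockLeadCoeff (B : Block n) : K :=
  if B.1.card = 1 then 1 else s (B.1.min' B.2) (B.1.max' B.2)

theorem wordWeight_pair {B : Finset (Fin n)} {i j : Fin n} (hi : i ∈ B) (hj : j ∈ B) (hij : i ≠ j) :
    wordWeight n (∑ k ∈ B, Finsupp.single (pairLabel i j k, k) 1) = (j : ℕ) - ((i : ℕ) : ℤ) := by
  classical
  rw [map_sum]
  have h : ∀ k ∈ B, wordWeight n (Finsupp.single (pairLabel i j k, k) 1) =
      (if k = j then ((j : ℕ) : ℤ) else 0) - (if k = i then ((i : ℕ) : ℤ) else 0) := by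
    intro k _
    rw [wordWeight, Finsupp.weight_single, one_smul]
    by_cases h1 : k = i
    · simp [pairLabel, h1, hij]
    · by_cases h2 : k = j
      · simp [pairLabel, h2, hij.symm]
      · simp [pairLabel, h1, h2]
  rw [Finset.sum_congr rfl h, Finset.sum_sub_distrib, Finset.sum_ite_eq' B j, Finset.sum_ite_eq' B i,
    if_pos hi, if_pos hj]

theorem prod_X_eq_monomial {σ ι : Type*} (B : Finset ι) (f : ι → σ) (a : K) :
    MvPolynomial.C a * ∏ k ∈ B, MvPolynomial.X (f k) =
      MvPolynomial.monomial (∑ k ∈ B, Finsupp.single (f k) 1) a := by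
  rw [MvPolynomial.monomial_sum_index]
  rfl

/-- The weight `j - i` is largest only for `i` minimal and `j` maximal in `B`; diagonal terms are
absent because `s i i = 0`. -/
theorem isLeadingTerm_blockPoly (h₀ : ∀ i, s i i = 0) (B : Block n) :
    IsLeadingTerm (wordWeight n) (blockPoly s B) (blockWord B) (blockLeadCoeff s B) := by
  by_cases hB : B.1.card = 1
  · have h1 : blockPoly s B = ∑ y ∈ ({()} : Finset Unit), MvPolynomial.monomial (blockWord B) 1 := by
      rw [Finset.sum_singleton, blockPoly, if_pos hB, blockWord, ← prod_X_eq_monomial, map_one,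
        one_mul]
      exact Finset.prod_congr rfl fun k _ => by rw [blockLetter, if_pos hB]
    have h2 : blockLeadCoeff s B = 1 := if_pos hB
    rw [h1, h2]
    exact isLeadingTerm_sum _ (fun _ => blockWord B) (fun _ => 1) (Finset.mem_singleton_self ())
      (fun y _ h => absurd rfl h)
  · have h1 : blockPoly s B = ∑ y ∈ B.1 ×ˢ B.1, MvPolynomial.monomial
        (∑ k ∈ B.1, Finsupp.single (pairLabel y.1 y.2 k, k) 1) (s y.1 y.2) := by
      rw [blockPoly, if_neg hB, pairPoly, Finset.sum_product]
      exact Finset.sum_congr rfl fun i _ => Finset.sum_congr rfl fun j _ => prod_X_eq_monomial _ _ _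
    have h2 : blockLeadCoeff s B = s (B.1.min' B.2) (B.1.max' B.2) := if_neg hB
    have h3 : blockWord B = ∑ k ∈ B.1,
        Finsupp.single (pairLabel (B.1.min' B.2) (B.1.max' B.2) k, k) 1 := by
      simp only [blockWord, blockLetter, if_neg hB]
    rw [h1, h2, h3]
    have hmin := B.1.min'_mem B.2
    have hmax := B.1.max'_mem B.2
    refine isLeadingTerm_sum (B.1 ×ˢ B.1)
      (fun y => ∑ k ∈ B.1, Finsupp.single (pairLabel y.1 y.2 k, k) 1) (fun y => s y.1 y.2)
      (x := (B.1.min' B.2, B.1.max' B.2)) (Finset.mem_product.2 ⟨hmin, hmax⟩) ?_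
    rintro ⟨i, j⟩ hy hne hs
    rw [Finset.mem_product] at hy
    have hij : i ≠ j := by
      rintro rfl
      exact hs (h₀ i)
    change wordWeight n (∑ k ∈ B.1, Finsupp.single (pairLabel i j k, k) 1) < _
    rw [wordWeight_pair (i := i) (j := j) hy.1 hy.2 hij,
      wordWeight_pair hmin hmax (Block.min'_lt_max' hB).ne]
    have l1 : B.1.min' B.2 ≤ i := B.1.min'_le i hy.1
    have l2 : j ≤ B.1.max' B.2 := B.1.le_max' j hy.2
    have l3 : B.1.min' B.2 ≠ i ∨ j ≠ B.1.max' B.2 := by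
      by_contra h
      push Not at h
      exact hne (by rw [h.1, h.2])
    rw [Fin.le_def] at l1 l2
    rw [ne_eq, ne_eq, Fin.ext_iff, Fin.ext_iff] at l3
    omega

/-- Singletons contribute 1, and the minima and maxima of the other blocks are all distinct because
the blocks are disjoint. -/
theorem prod_blockLeadCoeff_ne_zero
    (h₃ : ∀ L : List (Fin n × Fin n), (L.flatMap fun p => [p.1, p.2]).Nodup →
      (L.map fun p => s p.1 p.2).prod ≠ 0) {P : Finset (Block n)} (hP : IsNoncrossingFamily P) :
    ∏ B ∈ P, blockLeadCoeff s B ≠ 0 := by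
  classical
  let L := (P.filter fun B => B.1.card ≠ 1).toList.map fun B => (B.1.min' B.2, B.1.max' B.2)
  have hL : ∏ B ∈ P, blockLeadCoeff s B = (L.map fun p => s p.1 p.2).prod := by
    rw [List.map_map, Finset.prod_map_toList, Finset.prod_filter]
    refine Finset.prod_congr rfl fun B _ => ?_
    unfold blockLeadCoeff
    by_cases h : B.1.card = 1 <;> simp [h]
  rw [hL]
  apply h₃
  rw [List.flatMap_map, List.nodup_flatMap]
  constructor
  · intro B hB
    rw [Finset.mem_toList, Finset.mem_filter] at hB
    simpa using (Block.min'_lt_max' hB.2).ne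
  · refine (Finset.nodup_toList _).imp_of_mem ?_
    intro X Y hX hY hXY
    rw [Finset.mem_toList, Finset.mem_filter] at hX hY
    have hd := (hP X hX.1 Y hY.1 hXY).1
    have mem : ∀ Z : Block n, ∀ a ∈ [Z.1.min' Z.2, Z.1.max' Z.2], a ∈ Z.1 := by
      intro Z a ha
      simp only [List.mem_cons, List.not_mem_nil, or_false] at ha
      rcases ha with rfl | rfl
      · exact Z.1.min'_mem Z.2
      · exact Z.1.max'_mem Z.2
    exact fun a ha hb => Finset.disjoint_left.1 hd (mem X a ha) (mem Y a hb)

/-- The polynomials all of whose monomials have two letters at some position. -/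
noncomputable def repeatedLetterIdeal (n : ℕ) (K : Type*) [CommRing K] :
    Ideal (MvPolynomial (Fin 4 × Fin n) K) :=
  Ideal.span ((fun w => MvPolynomial.monomial w 1) '' {w | ∃ k, 2 ≤ ∑ a, w (a, k)})

theorem coeff_eq_zero_of_mem_repeatedLetterIdeal {f : MvPolynomial (Fin 4 × Fin n) K}
    (hf : f ∈ repeatedLetterIdeal n K) {w : Fin 4 × Fin n →₀ ℕ} (hw : ∀ k, ∑ a, w (a, k) ≤ 1) :
    f.coeff w = 0 := by
  by_contra h
  obtain ⟨u, ⟨k, hk⟩, huw⟩ := MvPolynomial.mem_ideal_span_monomial_image.1 hf w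
    (MvPolynomial.mem_support_iff.2 h)
  have := hk.trans (Finset.sum_le_sum fun a _ => huw (a, k))
  have := hw k
  omega

theorem blockPoly_mem_span {B : Block n} {k : Fin n} (hk : k ∈ B.1) :
    blockPoly s B ∈ Ideal.span (Set.range fun a : Fin 4 =>
      (MvPolynomial.X (a, k) : MvPolynomial (Fin 4 × Fin n) K)) := by
  have hprod : ∀ f : Fin n → Fin 4, ∏ m ∈ B.1, (MvPolynomial.X (f m, m) :
      MvPolynomial (Fin 4 × Fin n) K) ∈ Ideal.span (Set.range fun a : Fin 4 =>
        (MvPolynomial.X (a, k) : MvPolynomial (Fin 4 × Fin n) K)) := fun f =>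
    Ideal.mem_of_dvd _ (Finset.dvd_prod_of_mem _ hk) (Ideal.subset_span ⟨f k, rfl⟩)
  unfold blockPoly
  split_ifs
  · exact hprod fun _ => 3
  · exact Ideal.sum_mem _ fun i _ => Ideal.sum_mem _ fun j _ => Ideal.mul_mem_left _ _ (hprod _)

theorem blockPoly_mul_blockPoly_mem {A B : Block n} (h : (A.1 ∩ B.1).Nonempty) :
    blockPoly s A * blockPoly s B ∈ repeatedLetterIdeal n K := by
  obtain ⟨k, hk⟩ := h
  rw [Finset.mem_inter] at hk
  have h1 := Ideal.mul_mem_mul (blockPoly_mem_span s hk.1) (blockPoly_mem_span s hk.2)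
  rw [Ideal.span_mul_span'] at h1
  refine Ideal.span_le.2 ?_ h1
  rintro _ ⟨_, ⟨a, rfl⟩, _, ⟨b, rfl⟩, rfl⟩
  refine Ideal.subset_span ⟨Finsupp.single (a, k) 1 + Finsupp.single (b, k) 1, ⟨k, ?_⟩, ?_⟩
  · classical
    simp only [Finsupp.add_apply, Finsupp.single_apply, Prod.mk.injEq, and_true,
      Finset.sum_add_distrib, Finset.sum_ite_eq, Finset.mem_univ, if_true]
    exact le_rfl
  · simp [MvPolynomial.X, MvPolynomial.monomial_mul]

theorem aeval_mem_repeatedLetterIdeal [Algebra ℂ K] (h₀ : ∀ i, s i i = 0)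
    (h₁ : ∀ i j k l, s i j * s k l = - (s k j * s i l))
    (h₂ : ∀ i j k l, s i j * s k l = - (s i l * s k j))
    {f : MvPolynomial (Block n) ℂ} (hf : f ∈ crossingIdeal n ⊔ overlapIdeal n) :
    MvPolynomial.aeval (blockPoly s) f ∈ repeatedLetterIdeal n K := by
  have hle : crossingIdeal n ⊔ overlapIdeal n ≤
      (repeatedLetterIdeal n K).comap (MvPolynomial.aeval (blockPoly s)) := by
    refine sup_le (Ideal.span_le.2 ?_) (Ideal.span_le.2 ?_)
    · rintro _ ⟨A, B, hd, hc, rfl⟩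
      rw [SetLike.mem_coe, Ideal.mem_comap, aeval_crossingRelation s h₀ h₁ h₂ hd hc]
      exact Ideal.zero_mem _
    · rintro _ ⟨A, B, hAB, rfl⟩
      rw [SetLike.mem_coe, Ideal.mem_comap, map_mul, MvPolynomial.aeval_X, MvPolynomial.aeval_X]
      exact blockPoly_mul_blockPoly_mem s hAB
  exact hle hf

theorem linearIndependent_blockMonomial (n : ℕ) :
    LinearIndependent ℂ fun P : {P : Finset (Block n) // IsNoncrossingFamily P} =>
      Ideal.Quotient.mk (crossingIdeal n ⊔ overlapIdeal n) (blockMonomial P.1) := by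
  classical
  obtain ⟨K, _, _, s, h₀, h₁, h₂, h₃⟩ := exists_antisymmetric_pairing n
  rw [linearIndependent_iff']
  intro S g hsum P hP
  by_contra hgP
  -- Among the families that occur, one of greatest weight is chosen; its word has at most one
  -- letter per position, so its coefficient must vanish in the image of the relation.
  obtain ⟨P₀, hP₀, hmax⟩ := (S.filter fun P => g P ≠ 0).exists_max_image
    (fun P => wordWeight n (familyWord P.1)) ⟨P, Finset.mem_filter.2 ⟨hP, hgP⟩⟩
  rw [Finset.mem_filter] at hP₀
  have hlead (P : Finset (Block n)) : IsLeadingTerm (wordWeight n)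
      (∏ B ∈ P, blockPoly s B) (familyWord P) (∏ B ∈ P, blockLeadCoeff s B) :=
    IsLeadingTerm.prod P fun B _ => isLeadingTerm_blockPoly s h₀ B
  have hmem : ∑ P ∈ S, g P • blockMonomial P.1 ∈ crossingIdeal n ⊔ overlapIdeal n := by
    rw [← Ideal.Quotient.eq_zero_iff_mem, map_sum]
    exact hsum
  have hcoeff := coeff_eq_zero_of_mem_repeatedLetterIdeal
    (aeval_mem_repeatedLetterIdeal s h₀ h₁ h₂ hmem) (familyWord_multiplicity_le_one P₀.2)
  rw [map_sum, MvPolynomial.coeff_sum, Finset.sum_eq_single P₀] at hcoeff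
  · rw [map_smul, aeval_blockMonomial, MvPolynomial.coeff_smul, (hlead P₀.1).1] at hcoeff
    refine prod_blockLeadCoeff_ne_zero s h₃ P₀.2 ?_
    rw [← inv_smul_smul₀ hP₀.2 (∏ B ∈ P₀.1, blockLeadCoeff s B), hcoeff, smul_zero]
  · intro Q hQ hne
    rw [map_smul, aeval_blockMonomial, MvPolynomial.coeff_smul]
    by_cases hgQ : g Q = 0
    · rw [hgQ, zero_smul]
    -- The word of `P₀` is not the leading word of `Q`; if it occurred there, `Q` would have greater
    -- weight than `P₀`.
    · have hword : familyWord P₀.1 ≠ familyWord Q.1 := fun e =>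
        hne (Subtype.ext (familyWord_injOn P₀.2 Q.2 e)).symm
      have h0 : MvPolynomial.coeff (familyWord P₀.1) (∏ B ∈ Q.1, blockPoly s B) = 0 := by
        by_contra h
        exact absurd (hmax Q (Finset.mem_filter.2 ⟨hQ, hgQ⟩))
          (not_le.2 ((hlead Q.1).2 _ hword h))
      rw [h0, smul_zero]
  · exact fun h => absurd hP₀.1 h

end ModelIndependence

theorem proposition6p8 (n : ℕ) :
    ∃ b : Module.Basis {P : Finset (Block n) // IsNoncrossingFamily P} ℂ
        (MvPolynomial (Block n) ℂ ⧸ (crossingIdeal n ⊔ overlapIdeal n)),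
      ∀ P, b P = Ideal.Quotient.mk (crossingIdeal n ⊔ overlapIdeal n) (blockMonomial P.1) :=
  ⟨Module.Basis.mk (linearIndependent_blockMonomial n) (noncrossingSpan_eq_top n).ge,
    fun P => Module.Basis.mk_apply _ _ P⟩
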